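/- Let $\mathcal X,\mathcal Y$ be finite-dimensional real vector spaces, each with an inner product $\langle\cdot,\cdot\rangle$ and a norm $\|\cdot\|$ (not necessarily the induced one) with dual norm $\|\cdot\|_*$. Let $X\subseteq\mathcal X$, $Y\subseteq\mathcal Y$ be nonempty closed convex sets. Let $G$ be convex on $X$ and differentiable at the points of $X$, with $G(x')-G(x)-\langle\nabla G(x),x'-x\rangle\le\frac{L_G}{2}\|x'-x\|^2$ for all $x,x'\in X$, where $L_G\ge0$. Let $K:\mathcal X\to\mathcal Y$ be linear with $L_K=\|K\|:=\max\{\langle Kx,y\rangle:\|x\|\le1,\|y\|\le1\}$, and let $J:Y\to\mathbb R$ be convex and lower semicontinuous. For $\tilde z=(\tilde x,\tilde y)\in Z=X\times Y$ the gap function is $$g(\tilde z)=\max_{(x,y)\in Z}\big\{[G(\tilde x)+\langle K\tilde x,y\rangle-J(y)]-[G(x)+\langle Kx,\tilde y\rangle-J(\tilde y)]\big\}.$$ Let $d_X,d_Y$ be differentiable at the points of $X$, $Y$ and strongly convex on $X$, $Y$ with moduli $\alpha_X,\alpha_Y>0$, let $V_X(x,u)=d_X(x)-d_X(u)-\langle\nabla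 d_X(u),x-u\rangle$, define $V_Y$ in the same way, and assume that for some $\Omega_X,\Omega_Y>0$, $V_X\le\Omega_X^2$ on $X\times X$ and $V_Y\le\Omega_Y^2$ on $Y\times Y$. Put $D_X=\Omega_X\sqrt{2/\alpha_X}$, $D_Y=\Omega_Y\sqrt{2/\alpha_Y}$. A stochastic oracle is given by jointly measurable maps $\hat{\mathcal G}(x,\xi)$, $\hat{\mathcal K}_x(x,\xi)$, $\hat{\mathcal K}_y(y,\xi)$; the successive oracle calls use i.i.d. samples $\xi$. The outputs are unbiased, $\mathbb E\hat{\mathcal G}(x,\xi)=\nabla G(x)$, $\mathbb E\hat{\mathcal K}_x(x',\xi)=Kx'$, $\mathbb E\hat{\mathcal K}_y(y,\xi)=K^Ty$, for all $x\in X$, $y\in Y$ and $x'\in X'$, where $X'=\{u+(u-v):u,v\in X\}\supseteq X$. For given $\sigma_{x,G},\sigma_{x,K},\sigma_y\ge0$ put $\sigma_x=\sqrt{\sigma_{x,G}^2+\sigma_{x,K}^2}$ and consider the following assumptions, each for all $x\in X$, $x'\in X'$, $y\in Y$. * **A1.** $\mathbb E\|\hat{\mathcal G}(x,\xi)-\nabla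 G(x)\|_*^2\le\sigma_{x,G}^2$, $\ \mathbb E\|\hat{\mathcal K}_x(x',\xi)-Kx'\|_*^2\le\sigma_y^2$, $\ \mathbb E\|\hat{\mathcal K}_y(y,\xi)-K^Ty\|_*^2\le\sigma_{x,K}^2$. * **A2.** $\mathbb E\exp\{\|\nabla G(x)-\hat{\mathcal G}(x,\xi)\|_*^2/\sigma_{x,G}^2\}\le e$, $\ \mathbb E\exp\{\|Kx'-\hat{\mathcal K}_x(x',\xi)\|_*^2/\sigma_y^2\}\le e$, $\ \mathbb E\exp\{\|K^Ty-\hat{\mathcal K}_y(y,\xi)\|_*^2/\sigma_{x,K}^2\}\le e$ (an inequality whose $\sigma$ is $0$ is omitted). Let $N\ge2$ be given and consider the stochastic APD method: choose $x_1\in X$, $y_1\in Y$, set $x_1^{ag}=\bar x_1=x_1$, $y_1^{ag}=y_1$, and for $t=1,\dots,N-1$ compute $$\begin{aligned} x_t^{md}&=(1-\beta_t^{-1})x_t^{ag}+\beta_t^{-1}x_t,\\ y_{t+1}&=\operatorname{argmin}_{y\in Y}\ \langle-\hat{\mathcal K}_x(\bar x_t),y\rangle+J(y)+\tfrac1{\tau_t}V_Y(y,y_t),\\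 x_{t+1}&=\operatorname{argmin}_{x\in X}\ \langle\hat{\mathcal G}(x_t^{md}),x\rangle+\langle x,\hat{\mathcal K}_y(y_{t+1})\rangle+\tfrac1{\eta_t}V_X(x,x_t),\\ x_{t+1}^{ag}&=(1-\beta_t^{-1})x_t^{ag}+\beta_t^{-1}x_{t+1},\qquad y_{t+1}^{ag}=(1-\beta_t^{-1})y_t^{ag}+\beta_t^{-1}y_{t+1},\\ \bar x_{t+1}&=\theta_{t+1}(x_{t+1}-x_t)+x_{t+1}, \end{aligned}$$ where iteration $t$ makes two oracle calls with separate samples, one at $\bar x_t$ (yielding $\hat{\mathcal K}_x(\bar x_t)$) and then one at $(x_t^{md},y_{t+1})$ (yielding $\hat{\mathcal G}(x_t^{md})$ and $\hat{\mathcal K}_y(y_{t+1})$), with the parameters $$\beta_t=\frac{t+1}2,\quad\theta_t=\frac{t-1}t,\quad\eta_t=\frac{2\alpha_XD_Xt}{6L_GD_X+3L_KD_Y(N-1)+3\sigma_xN\sqrt{N-1}},\quad\tau_t=\frac{2\alpha_YD_Yt}{3L_KD_X(N-1)+3\sigma_yN\sqrt{N-1}},$$ the two denominators being assumed nonzero.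 Let $z_N^{ag}=(x_N^{ag},y_N^{ag})$. Under A1, $g(z_N^{ag})$ is integrable and $$\mathbb E[g(z_N^{ag})]\le\mathcal C_0(N):=\frac{6L_GD_X^2}{N(N-1)}+\frac{6L_KD_XD_Y}{N}+\frac{4(\sigma_xD_X+\sigma_yD_Y)}{\sqrt{N-1}}.$$ If in addition A2 holds, then for all $\lambda>0$ $$\operatorname{Prob}\{g(z_N^{ag})>\mathcal C_0(N)+\lambda\,\mathcal C_1(N)\}\le3e^{-\lambda^2/3}+3e^{-\lambda},\qquad\mathcal C_1(N):=\frac{3(\sigma_xD_X+\sigma_yD_Y)}{\sqrt{N-1}}.$$ -/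

import Mathlib

open MeasureTheory ProbabilityTheory
open scoped ENNReal

namespace StochAPD

/-- Bregman divergence `V(x, u) = d(x) - d(u) - ⟨∇d(u), x - u⟩`. -/
noncomputable def bregman {E : Type*} [NormedAddCommGroup E] [NormedSpace ℝ E]
    (d : E → ℝ) (x u : E) : ℝ :=
  d x - d u - fderiv ℝ d u (x - u)

/-- `d` is differentiable at the points of `X` and strongly convex on `X` with modulus `α > 0`
with respect to the given (arbitrary) norm. -/
structure IsProxFunction {E : Type*} [NormedAddCommGroup E] [NormedSpace ℝ E]
    (X : Set E) (d : E → ℝ) (α : ℝ) : Prop where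
  modulus_pos : 0 < α
  differentiableAt : ∀ u ∈ X, DifferentiableAt ℝ d u
  strongConvexOn : StrongConvexOn X α d

/-- The saddle point problem `min_{x ∈ X} max_{y ∈ Y} G(x) + ⟨Kx, y⟩ - J(y)`.
Gradients and the vectors `Kx` are regarded as elements of the dual space, so that `⟨Kx, y⟩` is
`K x y`, the transpose `Kᵀ` is `K.flip`, `‖K‖` is the norm induced by the norms of the two spaces,
and the norm of `StrongDual` is the dual norm `‖·‖_*`. -/
structure SaddleProblem (E F : Type*) [NormedAddCommGroup E] [NormedSpace ℝ E]
    [NormedAddCommGroup F] [NormedSpace ℝ F] where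
  X : Set E
  Y : Set F
  G : E → ℝ
  K : E →L[ℝ] StrongDual ℝ F
  J : F → ℝ
  LG : ℝ
  isClosed_X : IsClosed X
  convex_X : Convex ℝ X
  isClosed_Y : IsClosed Y
  convex_Y : Convex ℝ Y
  convexOn_G : ConvexOn ℝ X G
  differentiableAt_G : ∀ x ∈ X, DifferentiableAt ℝ G x
  LG_nonneg : 0 ≤ LG
  smooth_G : ∀ x ∈ X, ∀ x' ∈ X, G x' - G x - fderiv ℝ G x (x' - x) ≤ LG / 2 * ‖x' - x‖ ^ 2
  convexOn_J : ConvexOn ℝ Y J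
  lowerSemicontinuousOn_J : LowerSemicontinuousOn J Y

namespace SaddleProblem

variable {E F : Type*} [NormedAddCommGroup E] [NormedSpace ℝ E]
  [NormedAddCommGroup F] [NormedSpace ℝ F]

/-- `Q(z̃, z) = [G(x̃) + ⟨Kx̃, y⟩ - J(y)] - [G(x) + ⟨Kx, ỹ⟩ - J(ỹ)]`. -/
noncomputable def Q (S : SaddleProblem E F) (z' z : E × F) : ℝ :=
  (S.G z'.1 + S.K z'.1 z.2 - S.J z.2) - (S.G z.1 + S.K z.1 z'.2 - S.J z'.2)

/-- The gap function `g(z̃) = max_{z ∈ X × Y} Q(z̃, z)`.  (For bounded `X` and `Y` in finite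
dimension the set below is bounded above and its supremum is attained.) -/
noncomputable def gap (S : SaddleProblem E F) (z' : E × F) : ℝ :=
  sSup ((fun z => S.Q z' z) '' (S.X ×ˢ S.Y))

/-- The points `x + (x - x')` with `x, x' ∈ X`.  As `X` is convex, this set contains `X` and
every extrapolated point `x + θ (x - x')` with `0 ≤ θ ≤ 1`; the method evaluates the stochastic
operator for `K` at such points, which need not lie in `X`. -/
def extrapolated (S : SaddleProblem E F) : Set E :=
  {u | ∃ x ∈ S.X, ∃ x' ∈ S.X, u = x + (x - x')}

end SaddleProblem

/-- The stochastic oracle: on the input `(x, y)` and the sample `s` it returns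
`(𝒢(x, s), 𝒦_x(x, s), 𝒦_y(y, s))`. -/
structure Oracle (E F Ξ : Type*) [NormedAddCommGroup E] [NormedSpace ℝ E]
    [NormedAddCommGroup F] [NormedSpace ℝ F] [MeasurableSpace E] [MeasurableSpace F]
    [MeasurableSpace Ξ] where
  G : E → Ξ → StrongDual ℝ E
  Kx : E → Ξ → StrongDual ℝ F
  Ky : F → Ξ → StrongDual ℝ E
  measurable_G : Measurable (Function.uncurry G)
  measurable_Kx : Measurable (Function.uncurry Kx)
  measurable_Ky : Measurable (Function.uncurry Ky)

section Oracle

variable {E F Ξ : Type*} [NormedAddCommGroup E] [NormedSpace ℝ E]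
  [NormedAddCommGroup F] [NormedSpace ℝ F] [MeasurableSpace E] [MeasurableSpace F]
  [MeasurableSpace Ξ]

/-- The oracle outputs have finite expectations, equal to `∇G(x)`, `Kx`, `Kᵀy`, when the sample
has law `ν`. -/
structure Oracle.IsUnbiased (O : Oracle E F Ξ) (S : SaddleProblem E F) (ν : Measure Ξ) :
    Prop where
  integrable_G : ∀ x ∈ S.X, Integrable (O.G x) ν
  integrable_Kx : ∀ x ∈ S.extrapolated, Integrable (O.Kx x) ν
  integrable_Ky : ∀ y ∈ S.Y, Integrable (O.Ky y) ν
  mean_G : ∀ x ∈ S.X, ∫ s, O.G x s ∂ν = fderiv ℝ S.G x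
  mean_Kx : ∀ x ∈ S.extrapolated, ∫ s, O.Kx x s ∂ν = S.K x
  mean_Ky : ∀ y ∈ S.Y, ∫ s, O.Ky y s ∂ν = S.K.flip y

/-- Bounded variance: `E‖𝒢(x) - ∇G(x)‖_*² ≤ σ_{x,G}²`, `E‖𝒦_x(x) - Kx‖_*² ≤ σ_y²`,
`E‖𝒦_y(y) - Kᵀy‖_*² ≤ σ_{x,K}²`. -/
structure Oracle.BoundedVariance (O : Oracle E F Ξ) (S : SaddleProblem E F) (ν : Measure Ξ)
    (σxG σy σxK : ℝ) : Prop where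
  var_G : ∀ x ∈ S.X,
    ∫⁻ s, ENNReal.ofReal (‖O.G x s - fderiv ℝ S.G x‖ ^ 2) ∂ν ≤ ENNReal.ofReal (σxG ^ 2)
  var_Kx : ∀ x ∈ S.extrapolated,
    ∫⁻ s, ENNReal.ofReal (‖O.Kx x s - S.K x‖ ^ 2) ∂ν ≤ ENNReal.ofReal (σy ^ 2)
  var_Ky : ∀ y ∈ S.Y,
    ∫⁻ s, ENNReal.ofReal (‖O.Ky y s - S.K.flip y‖ ^ 2) ∂ν ≤ ENNReal.ofReal (σxK ^ 2)

/-- Light tails: `E exp(‖𝒢(x) - ∇G(x)‖_*² / σ_{x,G}²) ≤ e`, and similarly for `𝒦_x` with `σ_y`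
and for `𝒦_y` with `σ_{x,K}`.  (A line whose `σ` is `0` says nothing here; then the corresponding
noise vanishes almost surely by the bounded variance assumption.) -/
structure Oracle.LightTail (O : Oracle E F Ξ) (S : SaddleProblem E F) (ν : Measure Ξ)
    (σxG σy σxK : ℝ) : Prop where
  tail_G : ∀ x ∈ S.X,
    ∫⁻ s, ENNReal.ofReal (Real.exp (‖fderiv ℝ S.G x - O.G x s‖ ^ 2 / σxG ^ 2)) ∂ν
      ≤ ENNReal.ofReal (Real.exp 1)
  tail_Kx : ∀ x ∈ S.extrapolated,
    ∫⁻ s, ENNReal.ofReal (Real.exp (‖S.K x - O.Kx x s‖ ^ 2 / σy ^ 2)) ∂ν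
      ≤ ENNReal.ofReal (Real.exp 1)
  tail_Ky : ∀ y ∈ S.Y,
    ∫⁻ s, ENNReal.ofReal (Real.exp (‖S.K.flip y - O.Ky y s‖ ^ 2 / σxK ^ 2)) ∂ν
      ≤ ENNReal.ofReal (Real.exp 1)

/-- `u` is a minimizer of `f` over `C`. -/
def IsArgmin {V : Type*} (C : Set V) (f : V → ℝ) (u : V) : Prop :=
  u ∈ C ∧ ∀ v ∈ C, f u ≤ f v

/-- The random sequences produced by the stochastic accelerated primal-dual method with
parameters `β, θ, η, τ`, iterations `t = 1, …, N - 1`, from the initial point `(x₁, y₁) ∈ X × Y`.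
Iteration `t` calls the oracle twice, first at `x̄_t` and then, when `y_{t+1}` is known, at
`(x_t^{md}, y_{t+1})`; every call uses its own sample, `ξ (2t)` and `ξ (2t + 1)`. -/
structure IsRun {Ω : Type*} (S : SaddleProblem E F) (dX : E → ℝ) (dY : F → ℝ)
    (O : Oracle E F Ξ) (ξ : ℕ → Ω → Ξ) (N : ℕ) (β θ η τ : ℕ → ℝ) (x₁ : E) (y₁ : F)
    (x xmd xag xbar : ℕ → Ω → E) (y yag : ℕ → Ω → F) : Prop where
  x₁_mem : x₁ ∈ S.X
  y₁_mem : y₁ ∈ S.Y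
  x_one : ∀ ω, x 1 ω = x₁
  y_one : ∀ ω, y 1 ω = y₁
  xag_one : ∀ ω, xag 1 ω = x₁
  yag_one : ∀ ω, yag 1 ω = y₁
  xbar_one : ∀ ω, xbar 1 ω = x₁
  md_step : ∀ t, 1 ≤ t → t < N → ∀ ω,
    xmd t ω = (1 - (β t)⁻¹) • xag t ω + (β t)⁻¹ • x t ω
  y_step : ∀ t, 1 ≤ t → t < N → ∀ ω,
    IsArgmin S.Y (fun v => -(O.Kx (xbar t ω) (ξ (2 * t) ω) v) + S.J v
      + 1 / τ t * bregman dY v (y t ω)) (y (t + 1) ω)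
  x_step : ∀ t, 1 ≤ t → t < N → ∀ ω,
    IsArgmin S.X (fun u => O.G (xmd t ω) (ξ (2 * t + 1) ω) u
      + O.Ky (y (t + 1) ω) (ξ (2 * t + 1) ω) u
      + 1 / η t * bregman dX u (x t ω)) (x (t + 1) ω)
  xag_step : ∀ t, 1 ≤ t → t < N → ∀ ω,
    xag (t + 1) ω = (1 - (β t)⁻¹) • xag t ω + (β t)⁻¹ • x (t + 1) ω
  yag_step : ∀ t, 1 ≤ t → t < N → ∀ ω,
    yag (t + 1) ω = (1 - (β t)⁻¹) • yag t ω + (β t)⁻¹ • y (t + 1) ω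
  xbar_step : ∀ t, 1 ≤ t → t < N → ∀ ω,
    xbar (t + 1) ω = θ (t + 1) • (x (t + 1) ω - x t ω) + x (t + 1) ω

end Oracle

/-! The parameters; below `L_G`, `L_K`, `σ_x`, `σ_y`, `D_X`, `D_Y` are real arguments. -/

noncomputable def betaStep (t : ℕ) : ℝ := ((t : ℝ) + 1) / 2

noncomputable def thetaStep (t : ℕ) : ℝ := ((t : ℝ) - 1) / (t : ℝ)

noncomputable def etaStep (αX LG LK σx DX DY : ℝ) (N t : ℕ) : ℝ :=
  2 * αX * DX * (t : ℝ) /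
    (6 * LG * DX + 3 * LK * DY * ((N : ℝ) - 1) + 3 * σx * (N : ℝ) * √((N : ℝ) - 1))

noncomputable def tauStep (αY LK σy DX DY : ℝ) (N t : ℕ) : ℝ :=
  2 * αY * DY * (t : ℝ) /
    (3 * LK * DX * ((N : ℝ) - 1) + 3 * σy * (N : ℝ) * √((N : ℝ) - 1))

noncomputable def C₀ (LG LK σx σy DX DY : ℝ) (N : ℕ) : ℝ :=
  6 * LG * DX ^ 2 / ((N : ℝ) * ((N : ℝ) - 1)) + 6 * LK * DX * DY / (N : ℝ)
    + 4 * (σx * DX + σy * DY) / √((N : ℝ) - 1)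

noncomputable def C₁ (σx σy DX DY : ℝ) (N : ℕ) : ℝ :=
  3 * (σx * DX + σy * DY) / √((N : ℝ) - 1)

end StochAPD

open Filter Topology

namespace StochAPD

/-! ### Bregman divergences and the inequality for one proximal step -/

section Prox

variable {E : Type*} [NormedAddCommGroup E] [NormedSpace ℝ E]

/-! The heart is a bound for `S.Q` that holds on every sample path and at every comparison point
`(u, v)`, with a right-hand side free of `(u, v)` once the divergences from the starting points are
bounded. The supremum over `(u, v)` can then be taken before any probability enters.

Pathwise (`IsRun.weighted_Q_le`): with weight `t(t-1)/2` on the averaged point at time `t`,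
`SaddleProblem.Q_averaged_le` gives a recursion. The stepsizes are proportional to `t`, so the
proximal inequalities `prox_step_le`, multiplied by `t`, carry constant factors `px`, `py`, and
their divergences telescope. The extrapolation makes the bilinear term telescope up to a product of
two increments, which strong convexity absorbs.

The noise is paired with `(u, v)`, which would be random at the maximizer, so it is not a martingale
term as it stands. `noise_step_le` compares with an auxiliary proximal sequence `w` driven by the
noise alone: what remains is a squared noise norm, a telescoping divergence, and the noise paired
with `x t - wx t` or `y t - wy t`. These differences depend only on the past and are bounded by the
diameters `DX`, `DY`.

Probability: by `lintegral_past` and `integral_past` a fresh sample is integrated out with the past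
frozen. Hence the paired terms have mean zero and the squared terms are bounded by the variances,
which gives the expectation. For the tail there are six sums, one linear and one quadratic for each
of the three oracle outputs. `IsNoise.measureReal_sum_gt_le` (a Chernoff bound based on
`lintegral_exp_le`) treats the linear ones, `IsNoise.measureReal_sum_sq_gt_le` (Jensen and Markov)
the quadratic ones, and a union bound concludes.

Freezing the past needs measurable iterates, although minimizers are given only pointwise and `J` is
merely lower semicontinuous. `measurable_of_quadratic_growth` supplies this. -/

lemma tendsto_slope_fderiv {d : E → ℝ} {u : E} (hd : DifferentiableAt ℝ d u) (v : E) :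
    Tendsto (fun s : ℝ => s⁻¹ * (d (u + s • v) - d u)) (𝓝[>] 0) (𝓝 (fderiv ℝ d u v)) := by
  simpa using (hd.hasFDerivAt.hasLineDerivAt v).tendsto_slope_zero_right

lemma eventually_mem_Ioo_zero_one : ∀ᶠ s : ℝ in 𝓝[>] 0, 0 < s ∧ s < 1 :=
  Ioo_mem_nhdsGT one_pos

lemma segment_point (u v : E) (s : ℝ) : (1 - s) • u + s • v = u + s • (v - u) := by
  module

/-- The first order lower bound for strongly convex functions. -/
lemma le_bregman {X : Set E} {d : E → ℝ} {α : ℝ} (hd : StrongConvexOn X α d) {u v : E}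
    (hu : u ∈ X) (hv : v ∈ X) (hdu : DifferentiableAt ℝ d u) :
    α / 2 * ‖v - u‖ ^ 2 ≤ bregman d v u := by
  have h1 := tendsto_slope_fderiv hdu (v - u)
  have h2 : Tendsto (fun s : ℝ => d v - d u - (1 - s) * (α / 2 * ‖v - u‖ ^ 2)) (𝓝[>] 0)
      (𝓝 (d v - d u - (1 - 0) * (α / 2 * ‖v - u‖ ^ 2))) := by
    apply Tendsto.mono_left _ nhdsWithin_le_nhds
    apply Continuous.tendsto (f := fun s : ℝ => d v - d u - (1 - s) * (α / 2 * ‖v - u‖ ^ 2))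
    fun_prop
  -- Strong convexity at `(1 - s) • u + s • v`, divided by `s`; the limit `s → 0` gives the bound.
  have h3 := le_of_tendsto_of_tendsto h1 h2 (by
    filter_upwards [eventually_mem_Ioo_zero_one] with s ⟨hs0, hs1⟩
    have h := hd.2 hu hv (by linarith : 0 ≤ 1 - s) hs0.le (by ring)
    rw [segment_point, norm_sub_rev u v] at h
    simp only [smul_eq_mul] at h
    rw [inv_mul_le_iff₀ hs0]
    nlinarith)
  unfold bregman
  linarith

lemma fderiv_le_of_convexOn {X : Set E} {G : E → ℝ} (hG : ConvexOn ℝ X G) {u v : E}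
    (hu : u ∈ X) (hv : v ∈ X) (hdu : DifferentiableAt ℝ G u) :
    G u + fderiv ℝ G u (v - u) ≤ G v := by
  have h := le_bregman (strongConvexOn_zero.2 hG) hu hv hdu
  unfold bregman at h
  simp only [zero_div, zero_mul] at h
  linarith

/-- The optimality condition of a proximal step. -/
lemma prox_step_le {X : Set E} (hX : Convex ℝ X) {d J : E → ℝ} (hJ : ConvexOn ℝ X J)
    {g : StrongDual ℝ E} {ρ : ℝ} {u x' : E}
    (hx' : IsArgmin X (fun v => g v + J v + ρ * bregman d v u) x')
    (hd : DifferentiableAt ℝ d x') {v : E} (hv : v ∈ X) :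
    g (x' - v) + J x' - J v ≤ ρ * (bregman d v u - bregman d x' u - bregman d v x') := by
  have h1 := (tendsto_slope_fderiv hd (v - x')).const_mul ρ
  -- The minimizer is compared with the points `x' + s • (v - x')`; dividing by `s` and letting `s →
  -- 0` gives the variational inequality, to which the three-point identity for `bregman` is then
  -- applied.
  have h3 := ge_of_tendsto h1
    (b := g (x' - v) + J x' - J v + ρ * fderiv ℝ d u (v - x')) (by
    filter_upwards [eventually_mem_Ioo_zero_one] with s ⟨hs0, hs1⟩
    have hmem := hX hx'.1 hv (by linarith : 0 ≤ 1 - s) hs0.le (by ring)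
    have h := hx'.2 _ hmem
    have hJ' := hJ.2 hx'.1 hv (by linarith : 0 ≤ 1 - s) hs0.le (by ring)
    rw [segment_point] at h hJ'
    simp only [smul_eq_mul, bregman] at h hJ'
    have e : x' + s • (v - x') - u = (x' - u) + s • (v - x') := by abel
    have e2 : g (x' - v) = - g (v - x') := by rw [← map_neg, neg_sub]
    rw [e] at h
    simp only [map_add, map_smul, smul_eq_mul] at h
    rw [e2, mul_left_comm, le_inv_mul_iff₀ hs0]
    nlinarith)
  have e : fderiv ℝ d u (v - u) = fderiv ℝ d u (v - x') + fderiv ℝ d u (x' - u) := by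
    rw [← map_add]; congr 1; abel
  unfold bregman
  rw [e]
  linarith

/-- Young's inequality for a functional. -/
lemma dual_apply_le (e : StrongDual ℝ E) (v : E) {r : ℝ} (hr : 0 < r) :
    e v ≤ ‖e‖ ^ 2 / (4 * r) + r * ‖v‖ ^ 2 := by
  have h1 : e v ≤ ‖e‖ * ‖v‖ := (le_abs_self _).trans (e.le_opNorm v)
  have h2 : 0 ≤ (‖e‖ - 2 * r * ‖v‖) ^ 2 / (4 * r) := by positivity
  have h3 : (‖e‖ - 2 * r * ‖v‖) ^ 2 / (4 * r)
      = ‖e‖ ^ 2 / (4 * r) + r * ‖v‖ ^ 2 - ‖e‖ * ‖v‖ := by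
    field_simp; ring
  linarith

/-- The error of a perturbed proximal step, controlled by an auxiliary proximal sequence `w`. -/
lemma noise_step_le {X : Set E} (hX : Convex ℝ X) {d : E → ℝ} {α : ℝ}
    (hd : IsProxFunction X d α) {e : StrongDual ℝ E} {ρ r : ℝ} (hr : 0 < r) (hρ : 0 < ρ)
    (hrρ : r ≤ ρ * (α / 2)) {u u' w w' v : E} (hw : w ∈ X)
    (hw' : IsArgmin X (fun v => e v + ρ * bregman d v w) w') (hv : v ∈ X) :
    e (u' - v) ≤ ‖e‖ ^ 2 / (2 * r) + r * ‖u' - u‖ ^ 2 + e (u - w)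
      + ρ * (bregman d v w - bregman d v w') := by
  have h1 := dual_apply_le e (u' - u) hr
  have h2 := dual_apply_le e (w - w') hr
  have h3 : e (w' - v) ≤ ρ * (bregman d v w - bregman d w' w - bregman d v w') := by
    have := prox_step_le hX (J := fun _ => 0) (convexOn_const 0 hX) (g := e) (ρ := ρ) (u := w)
      (x' := w') (d := d) (by simpa using hw') (hd.differentiableAt _ hw'.1) hv
    simpa using this
  have h4 := le_bregman hd.strongConvexOn hw hw'.1 (hd.differentiableAt _ hw)
  have h5 : r * ‖w - w'‖ ^ 2 ≤ ρ * bregman d w' w := by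
    calc r * ‖w - w'‖ ^ 2 ≤ ρ * (α / 2) * ‖w - w'‖ ^ 2 := by gcongr
      _ = ρ * (α / 2 * ‖w' - w‖ ^ 2) := by rw [norm_sub_rev]; ring
      _ ≤ _ := by gcongr
  -- The first and third terms go to Young's inequality, the last to the optimality of `w'`. Only `e
  -- (u - w)` is left, and it involves neither `u'` nor `v`.
  have e1 : e (u' - v) = e (u' - u) + e (u - w) + e (w - w') + e (w' - v) := by
    simp only [map_sub]; ring
  have e2 : ‖e‖ ^ 2 / (2 * r) = ‖e‖ ^ 2 / (4 * r) + ‖e‖ ^ 2 / (4 * r) := by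
    field_simp; ring
  rw [e1, e2]
  linarith

lemma IsProxFunction.continuousOn {X : Set E} {d : E → ℝ} {α : ℝ}
    (hd : IsProxFunction X d α) : ContinuousOn d X :=
  fun u hu => (hd.differentiableAt u hu).continuousAt.continuousWithinAt

lemma IsProxFunction.bregman_nonneg {X : Set E} {d : E → ℝ} {α : ℝ}
    (hd : IsProxFunction X d α) {u v : E} (hu : u ∈ X) (hv : v ∈ X) : 0 ≤ bregman d v u := by
  have h1 := le_bregman hd.strongConvexOn hu hv (hd.differentiableAt _ hu)
  have h2 := hd.modulus_pos
  exact le_trans (by positivity) h1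

end Prox

/-! ### The pathwise estimate -/

section Deterministic

variable {E F : Type*} [NormedAddCommGroup E] [NormedSpace ℝ E]
  [NormedAddCommGroup F] [NormedSpace ℝ F]

/-- The new average differs from `xmd` by `b • (x' - xt)`, so smoothness costs only `b ^ 2`; this is
the acceleration. The gradient term is split by linearity between `xa` and `u`, and convexity of `G`
at `xmd` is used towards both. -/
lemma SaddleProblem.Q_averaged_le (S : SaddleProblem E F) {b : ℝ} (hb0 : 0 ≤ b) (hb1 : b ≤ 1)
    {xa xt x' u : E} {ya y' v : F} (hxa : xa ∈ S.X) (hxt : xt ∈ S.X) (hx' : x' ∈ S.X)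
    (hu : u ∈ S.X) (hya : ya ∈ S.Y) (hy' : y' ∈ S.Y) {xmd : E}
    (hmd : xmd = (1 - b) • xa + b • xt) :
    S.Q ((1 - b) • xa + b • x', (1 - b) • ya + b • y') (u, v) ≤ (1 - b) * S.Q (xa, ya) (u, v)
      + b * (fderiv ℝ S.G xmd (x' - u) + S.LG / 2 * b * ‖x' - xt‖ ^ 2
        + S.K x' v - S.K u y' + S.J y' - S.J v) := by
  have hb1' : 0 ≤ 1 - b := by linarith
  have hmdX : xmd ∈ S.X := by
    rw [hmd]; exact S.convex_X hxa hxt hb1' hb0 (by ring)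
  have hagX : (1 - b) • xa + b • x' ∈ S.X := S.convex_X hxa hx' hb1' hb0 (by ring)
  have hdiff := S.differentiableAt_G xmd hmdX
  have h1 := S.smooth_G xmd hmdX _ hagX
  have e1 : (1 - b) • xa + b • x' - xmd = b • (x' - xt) := by rw [hmd]; module
  have e2 : fderiv ℝ S.G xmd ((1 - b) • xa + b • x' - xmd)
      = (1 - b) * fderiv ℝ S.G xmd (xa - xmd)
        + b * (fderiv ℝ S.G xmd (u - xmd) + fderiv ℝ S.G xmd (x' - u)) := by
    rw [← map_add, ← smul_eq_mul, ← smul_eq_mul, ← map_smul, ← map_smul, ← map_add]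
    congr 1; module
  rw [e2, e1, norm_smul, mul_pow, Real.norm_eq_abs, sq_abs] at h1
  have h2 := mul_le_mul_of_nonneg_left (fderiv_le_of_convexOn S.convexOn_G hmdX hxa hdiff) hb1'
  have h3 := mul_le_mul_of_nonneg_left (fderiv_le_of_convexOn S.convexOn_G hmdX hu hdiff) hb0
  have h4 := S.convexOn_J.2 hya hy' hb1' hb0 (by ring)
  simp only [smul_eq_mul] at h4
  simp only [SaddleProblem.Q, map_add, map_smul, smul_eq_mul, add_apply,
    smul_apply]
  nlinarith

variable {Ξ Ω : Type*} [MeasurableSpace E] [MeasurableSpace F] [MeasurableSpace Ξ]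
  {S : SaddleProblem E F} {dX : E → ℝ} {dY : F → ℝ} {O : Oracle E F Ξ} {ξ : ℕ → Ω → Ξ}
  {N : ℕ} {η τ : ℕ → ℝ} {x₁ : E} {y₁ : F} {x xmd xag xbar : ℕ → Ω → E} {y yag : ℕ → Ω → F}

lemma one_le_betaStep {t : ℕ} (ht : 1 ≤ t) : 1 ≤ betaStep t := by
  have : (1 : ℝ) ≤ t := by exact_mod_cast ht
  unfold betaStep; linarith

lemma inv_betaStep_mem {t : ℕ} (ht : 1 ≤ t) : 0 ≤ (betaStep t)⁻¹ ∧ (betaStep t)⁻¹ ≤ 1 := by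
  have := one_le_betaStep ht
  exact ⟨by positivity, inv_le_one_of_one_le₀ this⟩

lemma IsRun.mem_x (h : IsRun S dX dY O ξ N betaStep thetaStep η τ x₁ y₁ x xmd xag xbar y yag)
    {t : ℕ} (h1 : 1 ≤ t) (hN : t ≤ N) (ω : Ω) : x t ω ∈ S.X := by
  obtain rfl | ⟨s, hs, rfl⟩ : t = 1 ∨ ∃ s, 1 ≤ s ∧ t = s + 1 := by
    rcases Nat.lt_or_ge 1 t with h | h
    · exact Or.inr ⟨t - 1, by omega, by omega⟩
    · exact Or.inl (by omega)
  · rw [h.x_one]; exact h.x₁_mem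
  · exact (h.x_step s hs (by omega) ω).1

lemma IsRun.mem_y (h : IsRun S dX dY O ξ N betaStep thetaStep η τ x₁ y₁ x xmd xag xbar y yag)
    {t : ℕ} (h1 : 1 ≤ t) (hN : t ≤ N) (ω : Ω) : y t ω ∈ S.Y := by
  obtain rfl | ⟨s, hs, rfl⟩ : t = 1 ∨ ∃ s, 1 ≤ s ∧ t = s + 1 := by
    rcases Nat.lt_or_ge 1 t with h | h
    · exact Or.inr ⟨t - 1, by omega, by omega⟩
    · exact Or.inl (by omega)
  · rw [h.y_one]; exact h.y₁_mem
  · exact (h.y_step s hs (by omega) ω).1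

lemma IsRun.mem_xag (h : IsRun S dX dY O ξ N betaStep thetaStep η τ x₁ y₁ x xmd xag xbar y yag)
    {t : ℕ} (h1 : 1 ≤ t) (hN : t ≤ N) (ω : Ω) : xag t ω ∈ S.X := by
  induction t, h1 using Nat.le_induction with
  | base => rw [h.xag_one]; exact h.x₁_mem
  | succ t ht ih =>
    rw [h.xag_step t ht (by omega)]
    obtain ⟨h0, h1⟩ := inv_betaStep_mem ht
    exact S.convex_X (ih (by omega)) (h.mem_x (by omega) hN ω) (by linarith) h0 (by ring)

lemma IsRun.mem_yag (h : IsRun S dX dY O ξ N betaStep thetaStep η τ x₁ y₁ x xmd xag xbar y yag)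
    {t : ℕ} (h1 : 1 ≤ t) (hN : t ≤ N) (ω : Ω) : yag t ω ∈ S.Y := by
  induction t, h1 using Nat.le_induction with
  | base => rw [h.yag_one]; exact h.y₁_mem
  | succ t ht ih =>
    rw [h.yag_step t ht (by omega)]
    obtain ⟨h0, h1⟩ := inv_betaStep_mem ht
    exact S.convex_Y (ih (by omega)) (h.mem_y (by omega) hN ω) (by linarith) h0 (by ring)

lemma IsRun.mem_xmd (h : IsRun S dX dY O ξ N betaStep thetaStep η τ x₁ y₁ x xmd xag xbar y yag)
    {t : ℕ} (h1 : 1 ≤ t) (hN : t < N) (ω : Ω) : xmd t ω ∈ S.X := by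
  rw [h.md_step t h1 hN]
  obtain ⟨h0, h1'⟩ := inv_betaStep_mem h1
  exact S.convex_X (h.mem_xag h1 hN.le ω) (h.mem_x h1 hN.le ω) (by linarith) h0 (by ring)

/-- Since `thetaStep` lies in `[0, 1]`, the extrapolated point is a full reflection step away from a
convex combination of the last two iterates. -/
lemma IsRun.mem_xbar (h : IsRun S dX dY O ξ N betaStep thetaStep η τ x₁ y₁ x xmd xag xbar y yag)
    {t : ℕ} (h1 : 1 ≤ t) (hN : t ≤ N) (ω : Ω) : xbar t ω ∈ S.extrapolated := by
  obtain rfl | ⟨s, hs, rfl⟩ : t = 1 ∨ ∃ s, 1 ≤ s ∧ t = s + 1 := by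
    rcases Nat.lt_or_ge 1 t with h | h
    · exact Or.inr ⟨t - 1, by omega, by omega⟩
    · exact Or.inl (by omega)
  · rw [h.xbar_one]; exact ⟨x₁, h.x₁_mem, x₁, h.x₁_mem, by simp⟩
  · rw [h.xbar_step s hs (by omega)]
    have hs0 : (0 : ℝ) < (s + 1 : ℕ) := by positivity
    have hs1 : (1 : ℝ) ≤ (s + 1 : ℕ) := by exact_mod_cast h1
    have t0 : 0 ≤ thetaStep (s + 1) := div_nonneg (by linarith) hs0.le
    have t1 : thetaStep (s + 1) ≤ 1 := by
      unfold thetaStep; rw [div_le_one hs0]; linarith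
    refine ⟨x (s + 1) ω, h.mem_x h1 hN ω,
      (1 - thetaStep (s + 1)) • x (s + 1) ω + thetaStep (s + 1) • x s ω,
      S.convex_X (h.mem_x h1 hN ω) (h.mem_x hs (by omega) ω) (by linarith) t0 (by ring), ?_⟩
    module

/-- The pathwise bound for the weighted gap in terms of the scaled noise `ex`, `ey` and the
auxiliary proximal sequences `wx`, `wy` driven by it. -/
theorem IsRun.weighted_Q_le
    (h : IsRun S dX dY O ξ N betaStep thetaStep η τ x₁ y₁ x xmd xag xbar y yag) (hN : 1 ≤ N)
    {αX αY : ℝ} (hdX : IsProxFunction S.X dX αX) (hdY : IsProxFunction S.Y dY αY)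
    {px py a b rx ry : ℝ} (hpx : 0 < px) (hpy : 0 < py) (hrx : 0 < rx) (hry : 0 < ry)
    (hη : ∀ t, 1 ≤ t → t < N → t * (1 / η t) = px)
    (hτ : ∀ t, 1 ≤ t → t < N → t * (1 / τ t) = py)
    (hax : 0 ≤ a) (hby : 0 ≤ b)
    (ha : a + S.LG + rx ≤ px * (αX / 2)) (hb : b + ry ≤ py * (αY / 2))
    (hab : ∀ p q : ℝ, 0 ≤ p → 0 ≤ q → ((N : ℝ) - 1) * (‖S.K‖ * p * q) ≤ a * p ^ 2 + b * q ^ 2)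
    (ω : Ω) {wx : ℕ → E} {wy : ℕ → F} {ex : ℕ → StrongDual ℝ E} {ey : ℕ → StrongDual ℝ F}
    (hex : ∀ t, 1 ≤ t → t < N → ex t = (-(t : ℝ)) • (O.G (xmd t ω) (ξ (2 * t + 1) ω)
      + O.Ky (y (t + 1) ω) (ξ (2 * t + 1) ω) - fderiv ℝ S.G (xmd t ω) - S.K.flip (y (t + 1) ω)))
    (hey : ∀ t, 1 ≤ t → t < N → ey t = (t : ℝ) • (O.Kx (xbar t ω) (ξ (2 * t) ω)
      - S.K (xbar t ω)))
    (hwx1 : wx 1 ∈ S.X) (hwy1 : wy 1 ∈ S.Y)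
    (hwx : ∀ t, 1 ≤ t → t < N →
      IsArgmin S.X (fun u => ex t u + px * bregman dX u (wx t)) (wx (t + 1)))
    (hwy : ∀ t, 1 ≤ t → t < N →
      IsArgmin S.Y (fun u => ey t u + py * bregman dY u (wy t)) (wy (t + 1)))
    {u : E} {v : F} (hu : u ∈ S.X) (hv : v ∈ S.Y) :
    (N : ℝ) * (N - 1) / 2 * S.Q (xag N ω, yag N ω) (u, v) ≤
      px * (bregman dX u x₁ + bregman dX u (wx 1)) + py * (bregman dY v y₁ + bregman dY v (wy 1))
      + ∑ t ∈ Finset.Ico 1 N, (‖ex t‖ ^ 2 / (2 * rx) + ex t (x t ω - wx t)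
        + ‖ey t‖ ^ 2 / (2 * ry) + ey t (y t ω - wy t)) := by
  have hwxX : ∀ t, 1 ≤ t → t ≤ N → wx t ∈ S.X := by
    intro t ht
    induction t, ht using Nat.le_induction with
    | base => exact fun _ => hwx1
    | succ t ht ih => exact fun hN => (hwx t ht hN).1
  have hwyY : ∀ t, 1 ≤ t → t ≤ N → wy t ∈ S.Y := by
    intro t ht
    induction t, ht using Nat.le_induction with
    | base => exact fun _ => hwy1
    | succ t ht ih => exact fun hN => (hwy t ht hN).1
  -- The last increment of `x`. At time `1` there is none, and nothing is known of `x 0`; the value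
  -- `0` matches `xbar 1 = x 1`.
  obtain ⟨inc, hinc1, hinc⟩ : ∃ inc : ℕ → E, inc 1 = 0 ∧
      ∀ t, 1 ≤ t → inc (t + 1) = x (t + 1) ω - x t ω :=
    ⟨fun t => if t = 1 then 0 else x t ω - x (t - 1) ω, by simp, fun t ht => by
      simp [show t ≠ 0 by omega]⟩
  have hK : ∀ (p : E) (q : F), |S.K p q| ≤ ‖S.K‖ * ‖p‖ * ‖q‖ := fun p q =>
    S.K.le_opNorm₂ p q
  -- The last two terms carry the induction: the pending bilinear term, to be cancelled by the
  -- extrapolation of the next step, and the reserve `a * ‖inc t‖ ^ 2` that pays for its error.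
  have key : ∀ t, 1 ≤ t → t ≤ N → (t : ℝ) * (t - 1) / 2 * S.Q (xag t ω, yag t ω) (u, v) ≤
      px * (bregman dX u x₁ + bregman dX u (wx 1)) + py * (bregman dY v y₁ + bregman dY v (wy 1))
      - px * (bregman dX u (x t ω) + bregman dX u (wx t))
      - py * (bregman dY v (y t ω) + bregman dY v (wy t))
      + ∑ s ∈ Finset.Ico 1 t, (‖ex s‖ ^ 2 / (2 * rx) + ex s (x s ω - wx s)
        + ‖ey s‖ ^ 2 / (2 * ry) + ey s (y s ω - wy s))
      - ((t : ℝ) - 1) * S.K (inc t) (y t ω - v) - a * ‖inc t‖ ^ 2 := by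
    intro t ht
    induction t, ht using Nat.le_induction with
    | base => intro _; simp [h.x_one, h.y_one, hinc1]
    | succ t ht ih =>
      intro htN
      have ih := ih (by omega)
      have ht1 : (1 : ℝ) ≤ t := by exact_mod_cast ht
      have htN' : (t : ℝ) ≤ N := by exact_mod_cast (by omega : t ≤ N)
      have htX := h.mem_x ht (by omega) ω
      have htY := h.mem_y ht (by omega) ω
      have htX' := h.mem_x (t := t + 1) (by omega) htN ω
      have htY' := h.mem_y (t := t + 1) (by omega) htN ω
      obtain ⟨hb0, hb1⟩ := inv_betaStep_mem ht
      -- the averaged iterates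
      have s1 := S.Q_averaged_le (v := v) hb0 hb1 (h.mem_xag ht (by omega) ω) htX htX' hu
        (h.mem_yag ht (by omega) ω) htY' (h.md_step t ht (by omega) ω)
      rw [← h.xag_step t ht (by omega), ← h.yag_step t ht (by omega)] at s1
      have hbeta : (betaStep t)⁻¹ = 2 / (t + 1) := by unfold betaStep; rw [inv_div]
      -- The weight `t(t+1)/2` turns `1 - 2/(t+1)` into `t(t-1)/2`, the weight of the previous step,
      -- and `2/(t+1)` into `t`.
      have s2 : (t + 1 : ℝ) * t / 2 * S.Q (xag (t + 1) ω, yag (t + 1) ω) (u, v)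
          ≤ t * (t - 1) / 2 * S.Q (xag t ω, yag t ω) (u, v)
            + t * (fderiv ℝ S.G (xmd t ω) (x (t + 1) ω - u)
              + S.K (x (t + 1) ω) v - S.K u (y (t + 1) ω) + S.J (y (t + 1) ω) - S.J v)
            + S.LG * ‖x (t + 1) ω - x t ω‖ ^ 2 := by
        have s3 := mul_le_mul_of_nonneg_left s1 (by positivity : 0 ≤ (t + 1 : ℝ) * t / 2)
        refine s3.trans ?_
        rw [hbeta, mul_add]
        have e1 : (t + 1 : ℝ) * t / 2 * ((1 - 2 / (t + 1)) * S.Q (xag t ω, yag t ω) (u, v))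
            = t * (t - 1) / 2 * S.Q (xag t ω, yag t ω) (u, v) := by
          field_simp; ring
        have e2 : ∀ A : ℝ, (t + 1 : ℝ) * t / 2 * (2 / (t + 1) * A) = t * A := by
          intro A; field_simp
        rw [e1, e2]
        have e3 : t * (S.LG / 2 * (2 / (t + 1)) * ‖x (t + 1) ω - x t ω‖ ^ 2)
            ≤ S.LG * ‖x (t + 1) ω - x t ω‖ ^ 2 := by
          have : t * (S.LG / 2 * (2 / (t + 1)) * ‖x (t + 1) ω - x t ω‖ ^ 2)
            = (t / (t + 1)) * (S.LG * ‖x (t + 1) ω - x t ω‖ ^ 2) := by field_simp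
          rw [this]
          apply mul_le_of_le_one_left
          · have := S.LG_nonneg; positivity
          · rw [div_le_one (by positivity)]; linarith
        linarith
      -- the two proximal steps
      have s4 := prox_step_le S.convex_Y S.convexOn_J
        (ρ := 1 / τ t) (g := -(O.Kx (xbar t ω) (ξ (2 * t) ω))) (by simpa using h.y_step t ht (by omega) ω)
        (hdY.differentiableAt _ htY') hv
      have s5 := prox_step_le S.convex_X (J := fun _ => 0) (convexOn_const 0 S.convex_X)
        (ρ := 1 / η t)
        (g := O.G (xmd t ω) (ξ (2 * t + 1) ω) + O.Ky (y (t + 1) ω) (ξ (2 * t + 1) ω))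
        (by simpa using h.x_step t ht (by omega) ω) (hdX.differentiableAt _ htX') hu
      have s4 := mul_le_mul_of_nonneg_left s4 (by linarith : (0 : ℝ) ≤ t)
      have s5 := mul_le_mul_of_nonneg_left s5 (by linarith : (0 : ℝ) ≤ t)
      -- After multiplication by `t` the factors of the divergences no longer depend on `t`, so
      -- these telescope.
      rw [← mul_assoc, hτ t ht (by omega)] at s4
      rw [← mul_assoc, hη t ht (by omega)] at s5
      -- the strong convexity
      have v1 := mul_le_mul_of_nonneg_left
        (le_bregman hdX.strongConvexOn htX htX' (hdX.differentiableAt _ htX)) hpx.le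
      have v2 := mul_le_mul_of_nonneg_left
        (le_bregman hdY.strongConvexOn htY htY' (hdY.differentiableAt _ htY)) hpy.le
      have v3 := mul_le_mul_of_nonneg_right ha (sq_nonneg ‖x (t + 1) ω - x t ω‖)
      have v4 := mul_le_mul_of_nonneg_right hb (sq_nonneg ‖y (t + 1) ω - y t ω‖)
      -- the noise
      have n1 := noise_step_le S.convex_X hdX hrx hpx (by linarith [S.LG_nonneg])
        (u := x t ω) (u' := x (t + 1) ω) (hwxX t ht (by omega)) (hwx t ht (by omega)) hu
      have n2 := noise_step_le S.convex_Y hdY hry hpy (by linarith)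
        (u := y t ω) (u' := y (t + 1) ω) (hwyY t ht (by omega)) (hwy t ht (by omega)) hv
      have n3 : ex t (x (t + 1) ω - u) = -(t * ((O.G (xmd t ω) (ξ (2 * t + 1) ω)
          + O.Ky (y (t + 1) ω) (ξ (2 * t + 1) ω)) (x (t + 1) ω - u)))
          + t * fderiv ℝ S.G (xmd t ω) (x (t + 1) ω - u)
          + t * S.K (x (t + 1) ω - u) (y (t + 1) ω) := by
        rw [hex t ht (by omega)]
        simp only [smul_apply, sub_apply,
          add_apply, ContinuousLinearMap.flip_apply, smul_eq_mul]
        ring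
      have n4 : ey t (y (t + 1) ω - v) = -(t * (-(O.Kx (xbar t ω) (ξ (2 * t) ω)))
          (y (t + 1) ω - v)) - t * S.K (xbar t ω) (y (t + 1) ω - v) := by
        rw [hey t ht (by omega)]
        simp only [smul_apply, sub_apply,
          neg_apply, smul_eq_mul]
        ring
      -- the extrapolation
      have b1 : (t : ℝ) • xbar t ω = (t : ℝ) • x t ω + ((t : ℝ) - 1) • inc t := by
        obtain rfl | ⟨s, hs, rfl⟩ : t = 1 ∨ ∃ s, 1 ≤ s ∧ t = s + 1 := by
          rcases Nat.lt_or_ge 1 t with h | h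
          · exact Or.inr ⟨t - 1, by omega, by omega⟩
          · exact Or.inl (by omega)
        · simp [h.xbar_one, h.x_one]
        · rw [h.xbar_step s hs (by omega), hinc s hs, smul_add, smul_smul, add_comm]
          congr 2
          unfold thetaStep
          field_simp
      have b2 : t * S.K (xbar t ω) (y (t + 1) ω - v) = t * S.K (x t ω) (y (t + 1) ω - v)
          + (t - 1) * S.K (inc t) (y (t + 1) ω - v) := by
        have := congrArg (fun z => S.K z (y (t + 1) ω - v)) b1
        simpa only [map_smul, map_add, smul_apply,
          add_apply, smul_eq_mul] using this
      -- The bilinear term telescopes except that `inc t` meets `y (t + 1)` instead of `y t`. This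
      -- is the cost of the mismatch.
      have b3 : (t - 1) * S.K (inc t) (y (t + 1) ω - y t ω)
          ≤ a * ‖inc t‖ ^ 2 + b * ‖y (t + 1) ω - y t ω‖ ^ 2 := by
        refine le_trans ?_ (hab ‖inc t‖ ‖y (t + 1) ω - y t ω‖ (norm_nonneg _) (norm_nonneg _))
        have c1 := le_trans (le_abs_self _) (hK (inc t) (y (t + 1) ω - y t ω))
        have c2 : 0 ≤ ‖S.K‖ * ‖inc t‖ * ‖y (t + 1) ω - y t ω‖ := by positivity
        calc _ ≤ ((t : ℝ) - 1) * (‖S.K‖ * ‖inc t‖ * ‖y (t + 1) ω - y t ω‖) :=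
              mul_le_mul_of_nonneg_left c1 (by linarith)
          _ ≤ _ := mul_le_mul_of_nonneg_right (by linarith) c2
      rw [Finset.sum_Ico_succ_top ht, hinc t ht]
      push_cast
      simp only [map_sub, sub_apply] at *
      linarith
  have hfin := key N hN le_rfl
  have hNX := h.mem_x hN le_rfl ω
  have hNY := h.mem_y hN le_rfl ω
  have hN1 : (1 : ℝ) ≤ N := by exact_mod_cast hN
  -- The bilinear term still pending at time `N` is absorbed by the reserve and by the final
  -- divergence from `y N` to `v`.
  have f1 : -(((N : ℝ) - 1) * S.K (inc N) (y N ω - v)) ≤ a * ‖inc N‖ ^ 2 + b * ‖v - y N ω‖ ^ 2 := by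
    rw [norm_sub_rev v]
    refine le_trans ?_ (hab ‖inc N‖ ‖y N ω - v‖ (norm_nonneg _) (norm_nonneg _))
    have c1 := le_trans (neg_le_abs _) (hK (inc N) (y N ω - v))
    rw [← mul_neg]
    exact mul_le_mul_of_nonneg_left c1 (by linarith)
  have f2 := mul_le_mul_of_nonneg_left
    (le_bregman hdY.strongConvexOn hNY hv (hdY.differentiableAt _ hNY)) hpy.le
  have f3 := mul_le_mul_of_nonneg_right hb (sq_nonneg ‖v - y N ω‖)
  have f4 : 0 ≤ ry * ‖v - y N ω‖ ^ 2 := by positivity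
  have f5 := mul_nonneg hpx.le (hdX.bregman_nonneg hNX hu)
  have f6 := mul_nonneg hpx.le (hdX.bregman_nonneg (hwxX N hN le_rfl) hu)
  have f7 := mul_nonneg hpy.le (hdY.bregman_nonneg (hwyY N hN le_rfl) hv)
  linarith

end Deterministic

/-! ### Measurability of minimizers and of the gap -/

section Measurability

/-- A sequence in `C` whose graph under `J` is dense in the graph of `J` over `C`. -/
lemma exists_seq_dense_graph {V : Type*} [PseudoMetricSpace V] [SecondCountableTopology V]
    {C : Set V} (hC : C.Nonempty) (J : V → ℝ) :
    ∃ q : ℕ → V, (∀ n, q n ∈ C) ∧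
      ∀ v ∈ C, ∀ U ∈ 𝓝 v, ∀ ε > 0, ∃ n, q n ∈ U ∧ |J (q n) - J v| < ε := by
  -- Separability of the graph, rather than of `C`, controls the values of `J` with no continuity
  -- assumption.
  let T : Set (V × ℝ) := (fun v => (v, J v)) '' C
  have : Nonempty T := ⟨⟨_, hC.choose, hC.choose_spec, rfl⟩⟩
  have hT : ∀ p : T, (p : V × ℝ).1 ∈ C ∧ (p : V × ℝ).2 = J (p : V × ℝ).1 := by
    rintro ⟨_, v, hv, rfl⟩; exact ⟨hv, rfl⟩
  refine ⟨fun n => (TopologicalSpace.denseSeq T n : V × ℝ).1, fun n => (hT _).1, ?_⟩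
  intro v hv U hU ε hε
  have hmem : (U ×ˢ Metric.ball (J v) ε) ∈ 𝓝 (v, J v) :=
    prod_mem_nhds hU (Metric.ball_mem_nhds _ hε)
  have hp : (Subtype.val ⁻¹' (U ×ˢ Metric.ball (J v) ε) : Set T) ∈
      𝓝 (⟨(v, J v), v, hv, rfl⟩ : T) :=
    continuous_subtype_val.continuousAt.preimage_mem_nhds hmem
  obtain ⟨_, hb, n, rfl⟩ := mem_closure_iff_nhds.1
    ((TopologicalSpace.denseRange_denseSeq T) ⟨(v, J v), v, hv, rfl⟩) _ hp
  refine ⟨n, hb.1, ?_⟩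
  have := hb.2
  rw [(hT _).2, Metric.mem_ball, Real.dist_eq] at this
  exact this

/-- A minimizer with quadratic growth depends measurably on the objective. -/
lemma measurable_of_quadratic_growth {V Ω : Type*} [NormedAddCommGroup V]
    [SecondCountableTopology V] [MeasurableSpace V] [BorelSpace V] {m : MeasurableSpace Ω}
    {C : Set V} {J : V → ℝ} {φ : Ω → V → ℝ} {u : Ω → V} {κ : ℝ} (hκ : 0 < κ)
    (hφ : ∀ v ∈ C, Measurable fun ω => φ ω v) (hφc : ∀ ω, ContinuousOn (φ ω) C)
    (hu : ∀ ω, u ω ∈ C)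
    (hmin : ∀ ω, ∀ v ∈ C, φ ω (u ω) + J (u ω) + κ * ‖v - u ω‖ ^ 2 ≤ φ ω v + J v) :
    Measurable u := by
  rcases isEmpty_or_nonempty Ω with hΩ | ⟨⟨ω₀⟩⟩
  · exact measurable_of_empty _
  obtain ⟨q, hqC, hq⟩ := exists_seq_dense_graph ⟨u ω₀, hu ω₀⟩ J
  have happ : ∀ ω, ∀ v ∈ C, ∀ U ∈ 𝓝 v, ∀ ε > 0, ∃ n, q n ∈ U ∧
      φ ω (q n) + J (q n) < φ ω v + J v + ε := by
    intro ω v hv U hU ε hε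
    have h1 : ∀ᶠ z in 𝓝[C] v, φ ω z < φ ω v + ε / 2 :=
      (hφc ω v hv).eventually_lt_const (by linarith)
    rw [eventually_nhdsWithin_iff] at h1
    obtain ⟨n, ⟨hn1, hn2⟩, hn3⟩ := hq v hv _ (inter_mem hU h1) (ε / 2) (by linarith)
    refine ⟨n, hn1, ?_⟩
    have := hn2 (hqC n)
    have := (abs_lt.1 hn3).2
    linarith
  refine measurable_of_isClosed' ?_
  intro A hA hA0 _
  -- The minimizer lies in `A` iff for every `n` some `q k` is both `1/(n+1)`-close to `A` and
  -- optimal up to `1/(n+1)` among all `q j`. Quadratic growth forces such near-minimizers to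
  -- converge to `u ω`.
  have hset : u ⁻¹' A = ⋂ n : ℕ, ⋃ k : ℕ, ⋂ j : ℕ,
      ({_ω | Metric.infDist (q k) A < 1 / ((n : ℝ) + 1)} ∩
        {ω | φ ω (q k) + J (q k) ≤ φ ω (q j) + J (q j) + 1 / ((n : ℝ) + 1)}) := by
    ext ω
    simp only [Set.mem_preimage, Set.mem_iInter, Set.mem_iUnion, Set.mem_inter_iff,
      Set.mem_ofPred_eq]
    constructor
    · intro hω n
      have hn : (0 : ℝ) < 1 / ((n : ℝ) + 1) := by positivity
      obtain ⟨k, hk1, hk2⟩ := happ ω _ (hu ω) _ (Metric.ball_mem_nhds _ hn) _ hn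
      refine ⟨k, fun j => ⟨(Metric.infDist_le_dist_of_mem hω).trans_lt hk1, ?_⟩⟩
      have := hmin ω _ (hqC j)
      have : 0 ≤ κ * ‖q j - u ω‖ ^ 2 := by positivity
      linarith
    · intro hω
      choose k hk using hω
      have hlim : Tendsto (fun n : ℕ => 1 / ((n : ℝ) + 1)) atTop (𝓝 0) :=
        tendsto_one_div_add_atTop_nhds_zero_nat
      have hgrow : ∀ n, κ * ‖q (k n) - u ω‖ ^ 2 ≤ 1 / ((n : ℝ) + 1) := by
        intro n
        have h1 := hmin ω _ (hqC (k n))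
        refine le_of_forall_pos_le_add fun ε hε => ?_
        obtain ⟨j, -, hj⟩ := happ ω _ (hu ω) _ univ_mem ε hε
        have := (hk n j).2
        linarith
      have hsq : Tendsto (fun n => ‖q (k n) - u ω‖ ^ 2) atTop (𝓝 0) := by
        refine squeeze_zero (fun n => by positivity)
          (fun n => (le_div_iff₀' hκ).2 (hgrow n)) ?_
        simpa using hlim.div_const κ
      have hq0 : Tendsto (fun n => q (k n)) atTop (𝓝 (u ω)) := by
        rw [tendsto_iff_norm_sub_tendsto_zero]
        have := hsq.sqrt
        simpa using this
      have h1 := ((Metric.continuous_infDist_pt A).tendsto (u ω)).comp hq0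
      have h2 : Metric.infDist (u ω) A ≤ 0 :=
        le_of_tendsto_of_tendsto h1 hlim (Eventually.of_forall fun n => ((hk n 0).1).le)
      exact (hA.mem_iff_infDist_zero hA0).2 (le_antisymm h2 Metric.infDist_nonneg)
  rw [hset]
  refine MeasurableSet.iInter fun n => MeasurableSet.iUnion fun k => MeasurableSet.iInter fun j =>
    (MeasurableSet.const _).inter (measurableSet_le ?_ ?_)
  · exact (hφ _ (hqC k)).add_const _
  · exact ((hφ _ (hqC j)).add_const _).add_const _

lemma measurable_comp_of_continuousOn {V Ω : Type*} [TopologicalSpace V] [MeasurableSpace V]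
    [BorelSpace V] {m : MeasurableSpace Ω} {C : Set V} {d : V → ℝ} (hd : ContinuousOn d C)
    {u : Ω → V} (hu : Measurable u) (huC : ∀ ω, u ω ∈ C) : Measurable fun ω => d (u ω) :=
  (continuousOn_iff_continuous_domRestrict.1 hd).measurable.comp (hu.subtype_mk (h := huC))

lemma measurable_comp_of_lowerSemicontinuousOn {V Ω : Type*} [TopologicalSpace V]
    [MeasurableSpace V] [BorelSpace V] {m : MeasurableSpace Ω} {C : Set V} {d : V → ℝ}
    (hd : LowerSemicontinuousOn d C) {u : Ω → V} (hu : Measurable u) (huC : ∀ ω, u ω ∈ C) :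
    Measurable fun ω => d (u ω) :=
  (lowerSemicontinuous_restrict_iff.2 hd).measurable.comp (hu.subtype_mk (h := huC))

/-- The derivative towards `v` is a limit of difference quotients along the segment to `v`. The
segment stays in `C`, where `d` is continuous, so nothing about `d` off `C` is used. -/
lemma measurable_bregman {V Ω : Type*} [NormedAddCommGroup V] [NormedSpace ℝ V]
    [SecondCountableTopology V]
    [MeasurableSpace V] [BorelSpace V] {m : MeasurableSpace Ω} {C : Set V} (hC : Convex ℝ C)
    {d : V → ℝ} {α : ℝ} (hd : IsProxFunction C d α) {u : Ω → V} (hu : Measurable u)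
    (huC : ∀ ω, u ω ∈ C) {v : V} (hv : v ∈ C) : Measurable fun ω => bregman d v (u ω) := by
  have hdu := measurable_comp_of_continuousOn hd.continuousOn hu huC
  have hder : Measurable fun ω => fderiv ℝ d (u ω) (v - u ω) := by
    have hs : Tendsto (fun n : ℕ => 1 / ((n : ℝ) + 1)) atTop (𝓝[>] 0) :=
      tendsto_nhdsWithin_iff.2 ⟨tendsto_one_div_add_atTop_nhds_zero_nat,
        Eventually.of_forall fun n => by simp only [Set.mem_Ioi]; positivity⟩
    refine measurable_of_tendsto_metrizable (f := fun (n : ℕ) ω => (1 / ((n : ℝ) + 1))⁻¹ *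
      (d (u ω + (1 / ((n : ℝ) + 1)) • (v - u ω)) - d (u ω))) (fun n => ?_) ?_
    · have hn0 : (0 : ℝ) ≤ 1 / ((n : ℝ) + 1) := by positivity
      have hn1 : 1 / ((n : ℝ) + 1) ≤ 1 := by
        rw [div_le_one (by positivity)]; linarith [(Nat.cast_nonneg n : (0 : ℝ) ≤ n)]
      refine ((measurable_comp_of_continuousOn hd.continuousOn ?_ fun ω => ?_).sub hdu).const_mul _
      · exact hu.add ((measurable_const.sub hu).const_smul _)
      · rw [← segment_point]
        exact hC (huC ω) hv (by linarith) hn0 (by ring)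
    · rw [tendsto_pi_nhds]
      exact fun ω => (tendsto_slope_fderiv (hd.differentiableAt _ (huC ω)) (v - u ω)).comp hs
  exact (measurable_const.sub hdu).sub hder

/-- A proximal step depends measurably on the functional and on the prox center. -/
lemma measurable_prox_step {V Ω : Type*} [NormedAddCommGroup V] [NormedSpace ℝ V]
    [FiniteDimensional ℝ V] [MeasurableSpace V] [BorelSpace V] {m : MeasurableSpace Ω}
    {C : Set V} (hC : Convex ℝ C) {d J : V → ℝ} {α : ℝ} (hd : IsProxFunction C d α)
    (hJ : ConvexOn ℝ C J) {g : Ω → StrongDual ℝ V} (hg : Measurable g) {ρ : ℝ} (hρ : 0 < ρ)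
    {u x' : Ω → V} (hu : Measurable u) (huC : ∀ ω, u ω ∈ C)
    (hx' : ∀ ω, IsArgmin C (fun v => g ω v + J v + ρ * bregman d v (u ω)) (x' ω)) :
    Measurable x' := by
  have hα := hd.modulus_pos
  refine measurable_of_quadratic_growth (C := C) (J := J) (κ := ρ * (α / 2))
    (φ := fun ω v => g ω v + ρ * bregman d v (u ω)) (by positivity) (fun v hv => ?_)
    (fun ω => ?_) (fun ω => (hx' ω).1) (fun ω v hv => ?_)
  · exact (((ContinuousLinearMap.apply ℝ ℝ v).continuous.measurable).comp hg).add
      ((measurable_bregman hC hd hu huC hv).const_mul _)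
  · refine (g ω).continuous.continuousOn.add (continuousOn_const.mul ?_)
    exact (hd.continuousOn.sub continuousOn_const).sub (by fun_prop)
  · have h1 := prox_step_le hC hJ (hx' ω) (hd.differentiableAt _ (hx' ω).1) hv
    have h2 := mul_le_mul_of_nonneg_left
      (le_bregman hd.strongConvexOn (hx' ω).1 hv (hd.differentiableAt _ (hx' ω).1)) hρ.le
    rw [map_sub] at h1
    linarith

lemma SaddleProblem.continuousOn_G {E F : Type*} [NormedAddCommGroup E] [NormedSpace ℝ E]
    [NormedAddCommGroup F] [NormedSpace ℝ F] (S : SaddleProblem E F) : ContinuousOn S.G S.X :=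
  fun u hu => (S.differentiableAt_G u hu).continuousAt.continuousWithinAt

variable {E F Ω : Type*} [NormedAddCommGroup E] [NormedSpace ℝ E] [FiniteDimensional ℝ E]
  [MeasurableSpace E] [BorelSpace E] [NormedAddCommGroup F] [NormedSpace ℝ F]
  [FiniteDimensional ℝ F] [MeasurableSpace F] [BorelSpace F]

/-- The supremum may be restricted to a sequence dense in the graph of the `J` part: the rest of `Q`
is continuous on `X × Y` in the comparison point. -/
lemma SaddleProblem.measurable_gap (S : SaddleProblem E F) {m : MeasurableSpace Ω}
    {u : Ω → E} {v : Ω → F} (hu : Measurable u) (hv : Measurable v) (huX : ∀ ω, u ω ∈ S.X)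
    (hvY : ∀ ω, v ω ∈ S.Y)
    (hbdd : ∀ ω, BddAbove ((fun z => S.Q (u ω, v ω) z) '' (S.X ×ˢ S.Y))) :
    Measurable fun ω => S.gap (u ω, v ω) := by
  rcases isEmpty_or_nonempty Ω with hΩ | ⟨⟨ω₀⟩⟩
  · exact measurable_of_empty _
  obtain ⟨q, hqC, hq⟩ := exists_seq_dense_graph (C := S.X ×ˢ S.Y)
    ⟨(u ω₀, v ω₀), huX ω₀, hvY ω₀⟩ (fun z => S.J z.2)
  refine measurable_of_Iic fun c => ?_
  have hset : (fun ω => S.gap (u ω, v ω)) ⁻¹' Set.Iic c =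
      ⋂ k : ℕ, {ω | S.Q (u ω, v ω) (q k) ≤ c} := by
    ext ω
    simp only [Set.mem_preimage, Set.mem_Iic, Set.mem_iInter, Set.mem_ofPred_eq]
    constructor
    · exact fun h k => (le_csSup (hbdd ω) ⟨q k, hqC k, rfl⟩).trans h
    · intro h
      refine csSup_le ⟨_, (u ω, v ω), ⟨huX ω, hvY ω⟩, rfl⟩ ?_
      rintro _ ⟨z, hz, rfl⟩
      refine le_of_forall_pos_le_add fun ε hε => ?_
      let φ : E × F → ℝ := fun z => S.K (u ω) z.2 - S.G z.1 - S.K z.1 (v ω)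
      have hφ : ContinuousOn φ (S.X ×ˢ S.Y) := by
        have h1 : ContinuousOn (fun z : E × F => S.G z.1) (S.X ×ˢ S.Y) :=
          S.continuousOn_G.comp continuousOn_fst fun z hz => hz.1
        exact (ContinuousOn.sub (by fun_prop) h1).sub (by fun_prop)
      have h1 : ∀ᶠ z' in 𝓝[S.X ×ˢ S.Y] z, φ z - ε / 2 < φ z' :=
        (hφ z hz).eventually_const_lt (by linarith)
      rw [eventually_nhdsWithin_iff] at h1
      obtain ⟨k, hk1, hk2⟩ := hq z hz _ h1 (ε / 2) (by linarith)
      have h2 := hk1 (hqC k)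
      have h3 := (abs_lt.1 hk2).2
      have h4 := h k
      simp only [φ, SaddleProblem.Q] at h2 h4 ⊢
      linarith
  rw [hset]
  refine MeasurableSet.iInter fun k => measurableSet_le ?_ measurable_const
  have m1 := measurable_comp_of_continuousOn S.continuousOn_G hu huX
  have m2 := measurable_comp_of_lowerSemicontinuousOn S.lowerSemicontinuousOn_J hv hvY
  have m3 : Measurable fun ω => S.K (u ω) (q k).2 :=
    (((ContinuousLinearMap.apply ℝ ℝ (q k).2).continuous.comp S.K.continuous).measurable).comp hu
  have m4 : Measurable fun ω => S.K (q k).1 (v ω) := (S.K (q k).1).continuous.measurable.comp hv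
  exact ((m1.add m3).sub measurable_const).sub ((measurable_const.add m4).sub m2)

end Measurability
-- Freezing the past
section Past

variable {Ω Ξ : Type*} [MeasurableSpace Ξ]

/-- The σ-algebra generated by the samples with index less than `k`. -/
abbrev past (ξ : ℕ → Ω → Ξ) (k : ℕ) : MeasurableSpace Ω :=
  ⨆ i ∈ Set.Iio k, MeasurableSpace.comap (ξ i) inferInstance

lemma past_mono {ξ : ℕ → Ω → Ξ} {k l : ℕ} (h : k ≤ l) : past ξ k ≤ past ξ l :=
  biSup_mono fun _ hi => lt_of_lt_of_le hi h

lemma measurable_past {ξ : ℕ → Ω → Ξ} {i k : ℕ} (h : i < k) : Measurable[past ξ k] (ξ i) :=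
  measurable_iff_comap_le.2 (le_biSup (fun i => MeasurableSpace.comap (ξ i) inferInstance) h)

variable {A : Type*} [mΩ : MeasurableSpace Ω] [MeasurableSpace A]

lemma past_le {ξ : ℕ → Ω → Ξ} (hξm : ∀ i, Measurable (ξ i)) (k : ℕ) : past ξ k ≤ mΩ :=
  iSup₂_le fun i _ => (hξm i).comap_le

variable {P : Measure Ω} {ν : Measure Ξ} {ξ : ℕ → Ω → Ξ}

lemma indepFun_past (hξm : ∀ i, Measurable (ξ i)) (hξi : iIndepFun ξ P) {k : ℕ} {Z : Ω → A}
    (hZ : Measurable[past ξ k] Z) : IndepFun Z (ξ k) P := by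
  have h := indep_iSup_of_disjoint (fun i => (hξm i).comap_le) hξi
    (S := Set.Iio k) (T := {k}) (by simp)
  simp only [Set.mem_singleton_iff, iSup_iSup_eq_left] at h
  exact indep_of_indep_of_le_left h hZ.comap_le

variable [IsProbabilityMeasure P]

/-- A variable of the past is independent of sample `k`, so their joint law is a product and Tonelli
applies. This replaces conditional expectations throughout. -/
lemma lintegral_past (hξm : ∀ i, Measurable (ξ i)) (hξ : ∀ i, P.map (ξ i) = ν)
    (hξi : iIndepFun ξ P) {k : ℕ} {Z : Ω → A} (hZ : Measurable[past ξ k] Z)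
    {h : A → Ξ → ℝ≥0∞} (hh : Measurable (Function.uncurry h)) :
    ∫⁻ ω, h (Z ω) (ξ k ω) ∂P = ∫⁻ ω, ∫⁻ s, h (Z ω) s ∂ν ∂P := by
  have hZ' : Measurable Z := hZ.mono (past_le hξm k) le_rfl
  have hν : IsProbabilityMeasure ν := by
    rw [← hξ 0]; exact Measure.isProbabilityMeasure_map (hξm 0).aemeasurable
  have hmap := (indepFun_iff_map_prod_eq_prod_map_map hZ'.aemeasurable
    (hξm k).aemeasurable).1 (indepFun_past hξm hξi hZ)
  rw [hξ k] at hmap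
  have h1 : ∫⁻ ω, h (Z ω) (ξ k ω) ∂P
      = ∫⁻ p, Function.uncurry h p ∂(P.map fun ω => (Z ω, ξ k ω)) :=
    (lintegral_map hh (hZ'.prodMk (hξm k))).symm
  rw [h1, hmap, lintegral_prod _ hh.aemeasurable]
  exact lintegral_map (f := fun z => ∫⁻ s, h z s ∂ν) hh.lintegral_prod_right' hZ'

lemma integral_past (hξm : ∀ i, Measurable (ξ i)) (hξ : ∀ i, P.map (ξ i) = ν)
    (hξi : iIndepFun ξ P) {k : ℕ} {Z : Ω → A} (hZ : Measurable[past ξ k] Z)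
    {h : A → Ξ → ℝ} (hh : Measurable (Function.uncurry h))
    (hint : Integrable (fun ω => h (Z ω) (ξ k ω)) P) :
    ∫ ω, h (Z ω) (ξ k ω) ∂P = ∫ ω, ∫ s, h (Z ω) s ∂ν ∂P := by
  have hZ' : Measurable Z := hZ.mono (past_le hξm k) le_rfl
  have hν : IsProbabilityMeasure ν := by
    rw [← hξ 0]; exact Measure.isProbabilityMeasure_map (hξm 0).aemeasurable
  have hmap := (indepFun_iff_map_prod_eq_prod_map_map hZ'.aemeasurable
    (hξm k).aemeasurable).1 (indepFun_past hξm hξi hZ)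
  rw [hξ k] at hmap
  have hpair : AEMeasurable (fun ω => (Z ω, ξ k ω)) P := (hZ'.prodMk (hξm k)).aemeasurable
  have h1 : ∫ ω, h (Z ω) (ξ k ω) ∂P
      = ∫ p, Function.uncurry h p ∂(P.map fun ω => (Z ω, ξ k ω)) :=
    (integral_map hpair hh.aestronglyMeasurable).symm
  have h2 : Integrable (Function.uncurry h) ((P.map Z).prod ν) := by
    rw [← hmap, integrable_map_measure hh.aestronglyMeasurable hpair]
    exact hint
  rw [h1, hmap, integral_prod _ h2]
  exact integral_map (f := fun z => ∫ s, h z s ∂ν) hZ'.aemeasurable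
    hh.stronglyMeasurable.integral_prod_right'.aestronglyMeasurable

end Past

/-! ### Exponential moments from light tails -/

section SubGaussian

/-- The linear term vanishes on integrating a centered variable, leaving a purely quadratic
exponent. -/
lemma exp_le_add_exp_sq (y : ℝ) : Real.exp y ≤ y + Real.exp (y ^ 2) := by
  have h2 := Real.add_one_le_exp (y ^ 2)
  rcases le_total 1 y with h | h
  · have : Real.exp y ≤ Real.exp (y ^ 2) := Real.exp_le_exp.2 (by nlinarith)
    linarith
  rcases le_total y (-1) with h' | h'
  · have : Real.exp y ≤ 1 := Real.exp_le_one_iff.2 (by linarith)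
    nlinarith
  · have := (abs_le.1 (Real.abs_exp_sub_one_sub_id_le (abs_le.2 ⟨h', h⟩))).2
    linarith

/-- Interpolation between `1` and `exp z`. -/
lemma exp_mul_le {c : ℝ} (hc0 : 0 ≤ c) (hc1 : c ≤ 1) (z : ℝ) :
    Real.exp (c * z) ≤ Real.exp c * (1 - c + c * (Real.exp z / Real.exp 1)) := by
  have h := convexOn_exp.2 (Set.mem_univ 0) (Set.mem_univ (z - 1)) (by linarith : 0 ≤ 1 - c) hc0
    (by ring)
  simp only [smul_eq_mul, mul_zero, zero_add, Real.exp_zero, mul_one, Real.exp_sub] at h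
  calc Real.exp (c * z) = Real.exp c * Real.exp (c * (z - 1)) := by
        rw [← Real.exp_add]; ring_nf
    _ ≤ _ := by gcongr

variable {Ξ : Type*} [MeasurableSpace Ξ] {ν : Measure Ξ}

lemma integrable_exp_of_lintegral_le {Z : Ξ → ℝ} (hZ : Measurable Z) {C : ℝ} (hC : 0 ≤ C)
    (h : ∫⁻ s, ENNReal.ofReal (Real.exp (Z s)) ∂ν ≤ ENNReal.ofReal C) :
    Integrable (fun s => Real.exp (Z s)) ν ∧ ∫ s, Real.exp (Z s) ∂ν ≤ C := by
  have hm : AEStronglyMeasurable (fun s => Real.exp (Z s)) ν := by fun_prop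
  have hpos : 0 ≤ᵐ[ν] fun s => Real.exp (Z s) := Eventually.of_forall fun s => (Real.exp_pos _).le
  constructor
  · rw [← lintegral_ofReal_ne_top_iff_integrable hm hpos]
    exact (h.trans_lt ENNReal.ofReal_lt_top).ne
  · rw [integral_eq_lintegral_of_nonneg_ae hpos hm]
    exact ENNReal.toReal_le_of_le_ofReal hC h

variable [IsProbabilityMeasure ν]

/-- The moment generating function of a centered variable dominated by `c * Z`, where `Z ^ 2` has
an exponential moment. -/
lemma lintegral_exp_le {Y Z : Ξ → ℝ} (hZ : Measurable Z)
    (hYi : Integrable Y ν) (hY0 : ∫ s, Y s ∂ν = 0) {c : ℝ} (hc : 0 ≤ c)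
    (hYZ : ∀ s, |Y s| ≤ c * Z s)
    (h : ∫⁻ s, ENNReal.ofReal (Real.exp (Z s ^ 2)) ∂ν ≤ ENNReal.ofReal (Real.exp 1)) :
    ∫⁻ s, ENNReal.ofReal (Real.exp (Y s)) ∂ν ≤ ENNReal.ofReal (Real.exp (c ^ 2)) := by
  obtain ⟨hi, hle⟩ := integrable_exp_of_lintegral_le (hZ.pow_const 2) (Real.exp_pos 1).le h
  have main : ∀ g : Ξ → ℝ, Integrable g ν → (∀ s, Real.exp (Y s) ≤ g s) →
      ∫ s, g s ∂ν ≤ Real.exp (c ^ 2) →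
      ∫⁻ s, ENNReal.ofReal (Real.exp (Y s)) ∂ν ≤ ENNReal.ofReal (Real.exp (c ^ 2)) := by
    intro g hg hle hint
    calc ∫⁻ s, ENNReal.ofReal (Real.exp (Y s)) ∂ν ≤ ∫⁻ s, ENNReal.ofReal (g s) ∂ν :=
          lintegral_mono fun s => ENNReal.ofReal_le_ofReal (hle s)
      _ = ENNReal.ofReal (∫ s, g s ∂ν) := by
          rw [ofReal_integral_eq_lintegral_ofReal hg
            (Eventually.of_forall fun s => (Real.exp_pos _).le.trans (hle s))]
      _ ≤ _ := ENNReal.ofReal_le_ofReal hint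
  have hq : ∀ q : ℝ, 0 ≤ q →
      ∫ s, (1 - q + q * (Real.exp (Z s ^ 2) / Real.exp 1)) ∂ν ≤ 1 := by
    intro q hq
    rw [integral_add (integrable_const _) ((hi.div_const _).const_mul _), integral_const_mul,
      integral_div]
    have : (∫ s, Real.exp (Z s ^ 2) ∂ν) / Real.exp 1 ≤ 1 :=
      (div_le_one (Real.exp_pos 1)).2 hle
    simp only [integral_const, probReal_univ, smul_eq_mul, one_mul]
    nlinarith
  have hqi : ∀ q : ℝ, Integrable (fun s => 1 - q + q * (Real.exp (Z s ^ 2) / Real.exp 1)) ν :=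
    fun q => (integrable_const _).add ((hi.div_const _).const_mul _)
  -- For `c ≤ 1`, centering removes the linear term and `exp (c ^ 2 * Z ^ 2)` is interpolated. For
  -- `c ≥ 1` centering is not needed: `c * Z ≤ c ^ 2 / 2 + Z ^ 2 / 2`, and the resulting exponent `c
  -- ^ 2 / 2 + 1 / 2` is at most `c ^ 2`.
  rcases le_total c 1 with h1 | h1
  · refine main (fun s => Y s + Real.exp (c ^ 2) *
      (1 - c ^ 2 + c ^ 2 * (Real.exp (Z s ^ 2) / Real.exp 1))) (hYi.add ((hqi _).const_mul _))
      (fun s => ?_) ?_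
    · refine (exp_le_add_exp_sq _).trans (add_le_add le_rfl ?_)
      refine le_trans (Real.exp_le_exp.2 ?_)
        (exp_mul_le (sq_nonneg c) (pow_le_one₀ hc h1) (Z s ^ 2))
      rw [← mul_pow, ← sq_abs]
      exact pow_le_pow_left₀ (abs_nonneg _) (hYZ s) 2
    · rw [integral_add hYi ((hqi _).const_mul _), hY0, integral_const_mul, zero_add]
      exact mul_le_of_le_one_right (Real.exp_pos _).le (hq _ (sq_nonneg c))
  · refine main (fun s => Real.exp (c ^ 2 / 2) * (Real.exp (1 / 2) *
      (1 - 1 / 2 + 1 / 2 * (Real.exp (Z s ^ 2) / Real.exp 1))))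
      (((hqi _).const_mul _).const_mul _) (fun s => ?_) ?_
    · refine le_trans ?_ (mul_le_mul_of_nonneg_left
        (exp_mul_le (by norm_num : (0 : ℝ) ≤ 1 / 2) (by norm_num) (Z s ^ 2)) (Real.exp_pos _).le)
      rw [← Real.exp_add, Real.exp_le_exp]
      have := (le_abs_self _).trans (hYZ s)
      nlinarith [sq_nonneg (c - Z s)]
    · rw [integral_const_mul, integral_const_mul, ← mul_assoc, ← Real.exp_add]
      refine (mul_le_of_le_one_right (Real.exp_pos _).le (hq _ (by norm_num))).trans ?_
      rw [Real.exp_le_exp]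
      nlinarith

end SubGaussian

/-! ### Moments and deviations of the oracle noise -/

section Noise

lemma measureReal_exp_le_of_lintegral_exp_le {Ω : Type*} [MeasurableSpace Ω] {P : Measure Ω}
    {Z : Ω → ℝ} (hZ : Measurable Z) {c b : ℝ}
    (h : ∫⁻ ω, ENNReal.ofReal (Real.exp (Z ω)) ∂P ≤ ENNReal.ofReal (Real.exp c)) :
    P.real {ω | b < Z ω} ≤ Real.exp (c - b) := by
  have h1 := mul_meas_ge_le_lintegral₀ (μ := P) (f := fun ω => ENNReal.ofReal (Real.exp (Z ω)))
    hZ.exp.ennreal_ofReal.aemeasurable (ENNReal.ofReal (Real.exp b))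
  have h2 : P {ω | b < Z ω} ≤ P {ω | ENNReal.ofReal (Real.exp b)
      ≤ ENNReal.ofReal (Real.exp (Z ω))} :=
    measure_mono fun ω hω => ENNReal.ofReal_le_ofReal (Real.exp_le_exp.2 (le_of_lt hω))
  refine ENNReal.toReal_le_of_le_ofReal (Real.exp_pos _).le ?_
  rw [Real.exp_sub, ENNReal.ofReal_div_of_pos (Real.exp_pos b)]
  rw [ENNReal.le_div_iff_mul_le (Or.inl (by simp [Real.exp_pos])) (Or.inl ENNReal.ofReal_ne_top),
    mul_comm]
  exact (mul_le_mul_right h2 _).trans (h1.trans h)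

variable {A V Ξ : Type*} [MeasurableSpace A] [NormedAddCommGroup V] [NormedSpace ℝ V]
  [MeasurableSpace Ξ]

/-- A centered random functional `D a`, measurable in the parameter `a`, whose dual norm has second
moment at most `σ ^ 2` for parameters in `T`. -/
structure IsNoise (D : A → Ξ → StrongDual ℝ V) (T : Set A) (ν : Measure Ξ) (σ : ℝ) : Prop where
  measurable : Measurable (Function.uncurry D)
  integrable : ∀ a ∈ T, Integrable (D a) ν
  mean : ∀ a ∈ T, ∫ s, D a s ∂ν = 0
  var : ∀ a ∈ T, ∫⁻ s, ENNReal.ofReal (‖D a s‖ ^ 2) ∂ν ≤ ENNReal.ofReal (σ ^ 2)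

/-- The squared dual norm of the noise has an exponential moment at scale `σ ^ 2`. -/
def HasLightTail (D : A → Ξ → StrongDual ℝ V) (T : Set A) (ν : Measure Ξ) (σ : ℝ) : Prop :=
  ∀ a ∈ T, ∫⁻ s, ENNReal.ofReal (Real.exp (‖D a s‖ ^ 2 / σ ^ 2)) ∂ν ≤ ENNReal.ofReal (Real.exp 1)

variable {D : A → Ξ → StrongDual ℝ V} {T : Set A} {ν : Measure Ξ} {σ : ℝ}

lemma IsNoise.measurable_apply (hD : IsNoise D T ν σ) (a : A) : Measurable (D a) :=
  hD.measurable.comp measurable_prodMk_left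

/-- At `σ = 0` the quotient in `HasLightTail` is `0` and the condition is void, so this case rests
on the variance bound. -/
lemma IsNoise.ae_eq_zero (hD : IsNoise D T ν 0) {a : A} (ha : a ∈ T) : ∀ᵐ s ∂ν, D a s = 0 := by
  have h := hD.var a ha
  have hm : Measurable fun s => ENNReal.ofReal (‖D a s‖ ^ 2) :=
    ((hD.measurable_apply a).norm.pow_const 2).ennreal_ofReal
  simp only [ne_eq, OfNat.ofNat_ne_zero, not_false_eq_true, zero_pow, ENNReal.ofReal_zero,
    nonpos_iff_eq_zero] at h
  rw [lintegral_eq_zero_iff hm] at h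
  filter_upwards [h] with s hs
  have hs : ‖D a s‖ ^ 2 ≤ 0 := ENNReal.ofReal_eq_zero.1 hs
  have : ‖D a s‖ = 0 := by nlinarith [norm_nonneg (D a s)]
  exact norm_eq_zero.1 this

lemma IsNoise.lintegral_exp_apply_le [IsProbabilityMeasure ν] (hD : IsNoise D T ν σ)
    (hσ : 0 ≤ σ) (hlt : HasLightTail D T ν σ) {a : A} (ha : a ∈ T) {v : V} {R : ℝ}
    (hv : ‖v‖ ≤ R) (s : ℝ) :
    ∫⁻ z, ENNReal.ofReal (Real.exp (s * D a z v)) ∂ν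
      ≤ ENNReal.ofReal (Real.exp (s ^ 2 * (σ * R) ^ 2)) := by
  have hR : 0 ≤ R := (norm_nonneg v).trans hv
  rcases hσ.eq_or_lt with rfl | hσ
  · have : ∫⁻ z, ENNReal.ofReal (Real.exp (s * D a z v)) ∂ν = ∫⁻ z, 1 ∂ν := by
      refine lintegral_congr_ae ?_
      filter_upwards [hD.ae_eq_zero ha] with z hz
      simp [hz]
    rw [this]; simp
  · have h := lintegral_exp_le (ν := ν) (Y := fun z => s * D a z v) (Z := fun z => ‖D a z‖ / σ)
      (c := |s| * (σ * R)) ((hD.measurable_apply a).norm.div_const σ)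
      (((hD.integrable a ha).apply_continuousLinearMap v).const_mul s) ?_ (by positivity) ?_ ?_
    · rwa [mul_pow, sq_abs] at h
    · rw [integral_const_mul, ← ContinuousLinearMap.integral_apply (hD.integrable a ha),
        hD.mean a ha]
      simp
    · intro z
      rw [abs_mul, mul_assoc]
      have h1 : |D a z v| ≤ ‖D a z‖ * R :=
        ((D a z).le_opNorm v).trans (by gcongr)
      have h2 : σ * R * (‖D a z‖ / σ) = ‖D a z‖ * R := by field_simp
      rw [h2]; gcongr
    · simpa only [div_pow] using hlt a ha

section Predictable

variable {Ω : Type*} {k : ℕ} {a : Ω → A} {w : Ω → V}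

lemma IsNoise.measurable_comp (hD : IsNoise D T ν σ) {m : MeasurableSpace Ω} {s : Ω → Ξ}
    (ha : Measurable[m] a) (hs : Measurable[m] s) : Measurable[m] fun ω => D (a ω) (s ω) :=
  hD.measurable.comp (ha.prodMk hs)

section

variable [FiniteDimensional ℝ V] [MeasurableSpace V] [BorelSpace V]

lemma IsNoise.measurable_pair (hD : IsNoise D T ν σ) :
    Measurable fun p : (A × V) × Ξ => D p.1.1 p.2 p.1.2 := by
  have h1 : Measurable fun p : (A × V) × Ξ => (D p.1.1 p.2, p.1.2) :=
    (hD.measurable.comp (measurable_fst.fst.prodMk measurable_snd)).prodMk measurable_fst.snd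
  have h2 : Continuous fun q : StrongDual ℝ V × V => q.1 q.2 := isBoundedBilinearMap_apply.continuous
  exact h2.measurable.comp h1

lemma IsNoise.measurable_comp_apply (hD : IsNoise D T ν σ) {m : MeasurableSpace Ω} {s : Ω → Ξ}
    (ha : Measurable[m] a) (hs : Measurable[m] s) (hw : Measurable[m] w) :
    Measurable[m] fun ω => D (a ω) (s ω) (w ω) :=
  hD.measurable_pair.comp ((ha.prodMk hw).prodMk hs)

end

variable [MeasurableSpace Ω] {P : Measure Ω} [IsProbabilityMeasure P] {ξ : ℕ → Ω → Ξ}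

lemma IsNoise.lintegral_sq_le (hD : IsNoise D T ν σ) (hξm : ∀ i, Measurable (ξ i))
    (hξ : ∀ i, P.map (ξ i) = ν) (hξi : iIndepFun ξ P) (ha : Measurable[past ξ k] a)
    (haT : ∀ ω, a ω ∈ T) :
    ∫⁻ ω, ENNReal.ofReal (‖D (a ω) (ξ k ω)‖ ^ 2) ∂P ≤ ENNReal.ofReal (σ ^ 2) := by
  rw [lintegral_past hξm hξ hξi ha (h := fun a s => ENNReal.ofReal (‖D a s‖ ^ 2))
    (hD.measurable.norm.pow_const 2).ennreal_ofReal]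
  calc _ ≤ ∫⁻ _, ENNReal.ofReal (σ ^ 2) ∂P := lintegral_mono fun ω => hD.var _ (haT ω)
    _ = _ := by simp

lemma IsNoise.integrable_sq (hD : IsNoise D T ν σ) (hξm : ∀ i, Measurable (ξ i))
    (hξ : ∀ i, P.map (ξ i) = ν) (hξi : iIndepFun ξ P) (ha : Measurable[past ξ k] a)
    (haT : ∀ ω, a ω ∈ T) :
    Integrable (fun ω => ‖D (a ω) (ξ k ω)‖ ^ 2) P ∧
      ∫ ω, ‖D (a ω) (ξ k ω)‖ ^ 2 ∂P ≤ σ ^ 2 := by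
  have h := hD.lintegral_sq_le hξm hξ hξi ha haT
  have hm : AEStronglyMeasurable (fun ω => ‖D (a ω) (ξ k ω)‖ ^ 2) P :=
    ((hD.measurable_comp (ha.mono (past_le hξm k) le_rfl) (hξm k)).norm.pow_const
      2).aestronglyMeasurable
  have hpos : 0 ≤ᵐ[P] fun ω => ‖D (a ω) (ξ k ω)‖ ^ 2 := Eventually.of_forall fun ω => sq_nonneg _
  constructor
  · rw [← lintegral_ofReal_ne_top_iff_integrable hm hpos]
    exact (h.trans_lt ENNReal.ofReal_lt_top).ne
  · rw [integral_eq_lintegral_of_nonneg_ae hpos hm]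
    exact ENNReal.toReal_le_of_le_ofReal (sq_nonneg σ) h

lemma IsNoise.ae_comp_eq_zero (hD : IsNoise D T ν 0) (hξm : ∀ i, Measurable (ξ i))
    (hξ : ∀ i, P.map (ξ i) = ν) (hξi : iIndepFun ξ P) (ha : Measurable[past ξ k] a)
    (haT : ∀ ω, a ω ∈ T) : ∀ᵐ ω ∂P, D (a ω) (ξ k ω) = 0 := by
  have h := hD.lintegral_sq_le hξm hξ hξi ha haT
  have hm : Measurable fun ω => ENNReal.ofReal (‖D (a ω) (ξ k ω)‖ ^ 2) :=
    ((hD.measurable_comp (ha.mono (past_le hξm k) le_rfl) (hξm k)).norm.pow_const 2).ennreal_ofReal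
  simp only [ne_eq, OfNat.ofNat_ne_zero, not_false_eq_true, zero_pow, ENNReal.ofReal_zero,
    nonpos_iff_eq_zero] at h
  rw [lintegral_eq_zero_iff hm] at h
  filter_upwards [h] with s hs
  have hs : ‖D (a s) (ξ k s)‖ ^ 2 ≤ 0 := ENNReal.ofReal_eq_zero.1 hs
  have : ‖D (a s) (ξ k s)‖ = 0 := by nlinarith [norm_nonneg (D (a s) (ξ k s))]
  exact norm_eq_zero.1 this

variable [FiniteDimensional ℝ V] [MeasurableSpace V] [BorelSpace V]

lemma IsNoise.integral_apply_eq_zero (hD : IsNoise D T ν σ) (hξm : ∀ i, Measurable (ξ i))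
    (hξ : ∀ i, P.map (ξ i) = ν) (hξi : iIndepFun ξ P) (ha : Measurable[past ξ k] a)
    (haT : ∀ ω, a ω ∈ T) (hw : Measurable[past ξ k] w) {R : ℝ} (hwR : ∀ ω, ‖w ω‖ ≤ R) :
    Integrable (fun ω => D (a ω) (ξ k ω) (w ω)) P ∧
      ∫ ω, D (a ω) (ξ k ω) (w ω) ∂P = 0 := by
  have hmono := past_le hξm k
  have hint : Integrable (fun ω => D (a ω) (ξ k ω) (w ω)) P := by
    refine ((((hD.integrable_sq hξm hξ hξi ha haT).1.add (integrable_const 1)).mul_const R)).mono'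
      (hD.measurable_comp_apply (ha.mono hmono le_rfl) (hξm k)
        (hw.mono hmono le_rfl)).aestronglyMeasurable (Eventually.of_forall fun ω => ?_)
    refine ((D (a ω) (ξ k ω)).le_opNorm (w ω)).trans ?_
    refine mul_le_mul ?_ (hwR ω) (norm_nonneg _) (by simp only [Pi.add_apply]; positivity)
    simp only [Pi.add_apply]
    nlinarith [sq_nonneg (‖D (a ω) (ξ k ω)‖ - 1), norm_nonneg (D (a ω) (ξ k ω))]
  refine ⟨hint, ?_⟩
  rw [integral_past hξm hξ hξi (ha.prodMk hw) (h := fun q s => D q.1 s q.2) hD.measurable_pair hint]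
  refine integral_eq_zero_of_ae (Eventually.of_forall fun ω => ?_)
  simp only [Pi.zero_apply]
  rw [← ContinuousLinearMap.integral_apply (hD.integrable _ (haT ω)), hD.mean _ (haT ω)]
  simp

end Predictable

section Deviation

variable {Ω : Type*} [MeasurableSpace Ω] {P : Measure Ω} [IsProbabilityMeasure P]
  {ξ : ℕ → Ω → Ξ} {k : ℕ → ℕ} {a : ℕ → Ω → A} {N : ℕ}

/-- The second moments of weighted sums of squared noise norms. -/
lemma IsNoise.integrable_sum_sq (hD : IsNoise D T ν σ) (hξm : ∀ i, Measurable (ξ i))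
    (hξ : ∀ i, P.map (ξ i) = ν) (hξi : iIndepFun ξ P)
    (ha : ∀ t, 1 ≤ t → t < N → Measurable[past ξ (k t)] (a t))
    (haT : ∀ t, 1 ≤ t → t < N → ∀ ω, a t ω ∈ T) :
    Integrable (fun ω => ∑ t ∈ Finset.Ico 1 N, (t : ℝ) ^ 2 * ‖D (a t ω) (ξ (k t) ω)‖ ^ 2) P ∧
      ∫ ω, ∑ t ∈ Finset.Ico 1 N, (t : ℝ) ^ 2 * ‖D (a t ω) (ξ (k t) ω)‖ ^ 2 ∂P
        ≤ σ ^ 2 * ∑ t ∈ Finset.Ico 1 N, (t : ℝ) ^ 2 := by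
  have h : ∀ t ∈ Finset.Ico 1 N, Integrable (fun ω => ‖D (a t ω) (ξ (k t) ω)‖ ^ 2) P ∧
      ∫ ω, ‖D (a t ω) (ξ (k t) ω)‖ ^ 2 ∂P ≤ σ ^ 2 := by
    intro t ht
    obtain ⟨ht1, ht2⟩ := Finset.mem_Ico.1 ht
    exact hD.integrable_sq hξm hξ hξi (ha t ht1 ht2) (haT t ht1 ht2)
  refine ⟨integrable_finsetSum _ fun t ht => (h t ht).1.const_mul _, ?_⟩
  rw [integral_finsetSum _ fun t ht => (h t ht).1.const_mul _, Finset.mul_sum]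
  refine Finset.sum_le_sum fun t ht => ?_
  rw [integral_const_mul, mul_comm]
  gcongr
  exact (h t ht).2

/-- The large deviation bound for a weighted sum of squared noise norms. -/
lemma IsNoise.measureReal_sum_sq_gt_le (hD : IsNoise D T ν σ) (hσ : 0 ≤ σ)
    (hlt : HasLightTail D T ν σ) (hξm : ∀ i, Measurable (ξ i))
    (hξ : ∀ i, P.map (ξ i) = ν) (hξi : iIndepFun ξ P)
    (ha : ∀ t, 1 ≤ t → t < N → Measurable[past ξ (k t)] (a t))
    (haT : ∀ t, 1 ≤ t → t < N → ∀ ω, a t ω ∈ T) (hN : 2 ≤ N) (r : ℝ) :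
    P.real {ω | (1 + r) * (σ ^ 2 * ∑ t ∈ Finset.Ico 1 N, (t : ℝ) ^ 2) <
        ∑ t ∈ Finset.Ico 1 N, (t : ℝ) ^ 2 * ‖D (a t ω) (ξ (k t) ω)‖ ^ 2}
      ≤ Real.exp (-r) := by
  rcases hσ.eq_or_lt with rfl | hσ'
  · have h0 : ∀ᵐ ω ∂P, ∀ t ∈ Finset.Ico 1 N, D (a t ω) (ξ (k t) ω) = 0 := by
      rw [Filter.eventually_all_finset]
      intro t ht
      obtain ⟨ht1, ht2⟩ := Finset.mem_Ico.1 ht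
      exact hD.ae_comp_eq_zero hξm hξ hξi (ha t ht1 ht2) (haT t ht1 ht2)
    have : P.real {ω | (1 + r) * (0 ^ 2 * ∑ t ∈ Finset.Ico 1 N, (t : ℝ) ^ 2) <
        ∑ t ∈ Finset.Ico 1 N, (t : ℝ) ^ 2 * ‖D (a t ω) (ξ (k t) ω)‖ ^ 2} = 0 := by
      rw [measureReal_eq_zero_iff]
      refine measure_eq_zero_iff_ae_notMem.2 ?_
      filter_upwards [h0] with ω hω
      have hz : ∑ t ∈ Finset.Ico 1 N, (t : ℝ) ^ 2 * ‖D (a t ω) (ξ (k t) ω)‖ ^ 2 = 0 :=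
        Finset.sum_eq_zero fun t ht => by rw [hω t ht]; simp
      simp [hz]
    rw [this]; exact (Real.exp_pos _).le
  set S : ℝ := ∑ t ∈ Finset.Ico 1 N, (t : ℝ) ^ 2 with hSdef
  have hS : 0 < S := by
    refine Finset.sum_pos (fun t ht => ?_) ⟨1, Finset.mem_Ico.2 ⟨le_rfl, by omega⟩⟩
    have : (0 : ℝ) < t := by exact_mod_cast (Finset.mem_Ico.1 ht).1
    positivity
  have hmeas : ∀ t ∈ Finset.Ico 1 N, Measurable fun ω => ‖D (a t ω) (ξ (k t) ω)‖ ^ 2 := by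
    intro t ht
    obtain ⟨ht1, ht2⟩ := Finset.mem_Ico.1 ht
    exact (hD.measurable_comp ((ha t ht1 ht2).mono (past_le hξm _) le_rfl) (hξm _)).norm.pow_const 2
  have hexp : ∀ t ∈ Finset.Ico 1 N,
      ∫⁻ ω, ENNReal.ofReal (Real.exp (‖D (a t ω) (ξ (k t) ω)‖ ^ 2 / σ ^ 2)) ∂P
        ≤ ENNReal.ofReal (Real.exp 1) := by
    intro t ht
    obtain ⟨ht1, ht2⟩ := Finset.mem_Ico.1 ht
    rw [lintegral_past hξm hξ hξi (ha t ht1 ht2)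
      (h := fun a z => ENNReal.ofReal (Real.exp (‖D a z‖ ^ 2 / σ ^ 2)))
      ((hD.measurable.norm.pow_const 2).div_const (σ ^ 2)).exp.ennreal_ofReal]
    calc _ ≤ ∫⁻ _, ENNReal.ofReal (Real.exp 1) ∂P :=
          lintegral_mono fun ω => hlt _ (haT t ht1 ht2 ω)
      _ = _ := by simp
  -- With normalized weights, Jensen bounds the exponential of the average by the average of
  -- exponentials; no independence between the summands is needed.
  have hsum1 : ∑ t ∈ Finset.Ico 1 N, (t : ℝ) ^ 2 / S = 1 := by
    rw [← Finset.sum_div, ← hSdef, div_self hS.ne']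
  have h1 : ∫⁻ ω, ENNReal.ofReal (Real.exp (∑ t ∈ Finset.Ico 1 N,
      (t : ℝ) ^ 2 / S * (‖D (a t ω) (ξ (k t) ω)‖ ^ 2 / σ ^ 2))) ∂P
        ≤ ENNReal.ofReal (Real.exp 1) := by
    calc _ ≤ ∫⁻ ω, ∑ t ∈ Finset.Ico 1 N, ENNReal.ofReal ((t : ℝ) ^ 2 / S) *
          ENNReal.ofReal (Real.exp (‖D (a t ω) (ξ (k t) ω)‖ ^ 2 / σ ^ 2)) ∂P := by
          refine lintegral_mono fun ω => ?_
          have hofReal : ∀ t : ℕ, ∀ z : ℝ, ENNReal.ofReal ((t : ℝ) ^ 2 / S) * ENNReal.ofReal z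
              = ENNReal.ofReal ((t : ℝ) ^ 2 / S * z) :=
            fun t z => (ENNReal.ofReal_mul (by positivity)).symm
          simp only [hofReal]
          rw [← ENNReal.ofReal_sum_of_nonneg fun t _ => by positivity]
          refine ENNReal.ofReal_le_ofReal ?_
          have := convexOn_exp.map_sum_le (t := Finset.Ico 1 N)
            (w := fun t : ℕ => (t : ℝ) ^ 2 / S)
            (p := fun t => ‖D (a t ω) (ξ (k t) ω)‖ ^ 2 / σ ^ 2)
            (fun t _ => by positivity) hsum1 (fun t _ => Set.mem_univ _)
          simpa only [smul_eq_mul] using this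
      _ = ∑ t ∈ Finset.Ico 1 N, ENNReal.ofReal ((t : ℝ) ^ 2 / S) *
          ∫⁻ ω, ENNReal.ofReal (Real.exp (‖D (a t ω) (ξ (k t) ω)‖ ^ 2 / σ ^ 2)) ∂P := by
          rw [lintegral_finsetSum]
          · exact Finset.sum_congr rfl fun t _ => lintegral_const_mul' _ _ ENNReal.ofReal_ne_top
          · exact fun t ht => (((hmeas t ht).div_const _).exp.ennreal_ofReal).const_mul _
      _ ≤ ∑ t ∈ Finset.Ico 1 N, ENNReal.ofReal ((t : ℝ) ^ 2 / S) *
          ENNReal.ofReal (Real.exp 1) :=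
          Finset.sum_le_sum fun t ht => mul_le_mul_right (hexp t ht) _
      _ = _ := by
          rw [← Finset.sum_mul, ← ENNReal.ofReal_sum_of_nonneg fun t _ => by positivity, hsum1]
          simp
  have h2 := measureReal_exp_le_of_lintegral_exp_le (Finset.measurable_sum _ fun t ht =>
    ((hmeas t ht).div_const _).const_mul _) h1 (b := 1 + r)
  refine le_trans (le_of_eq ?_) (h2.trans (le_of_eq (by ring_nf)))
  congr 1
  ext ω
  simp only [Set.mem_ofPred_eq]
  have h3 : ∑ t ∈ Finset.Ico 1 N, (t : ℝ) ^ 2 / S * (‖D (a t ω) (ξ (k t) ω)‖ ^ 2 / σ ^ 2)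
      = (∑ t ∈ Finset.Ico 1 N, (t : ℝ) ^ 2 * ‖D (a t ω) (ξ (k t) ω)‖ ^ 2) / (σ ^ 2 * S) := by
    rw [Finset.sum_div]
    exact Finset.sum_congr rfl fun t _ => by field_simp
  rw [h3, lt_div_iff₀ (by positivity)]

variable [FiniteDimensional ℝ V] [MeasurableSpace V] [BorelSpace V] {w : ℕ → Ω → V}

/-- Weighted sums of martingale differences have mean zero. -/
lemma IsNoise.integral_sum_eq_zero (hD : IsNoise D T ν σ) (hξm : ∀ i, Measurable (ξ i))
    (hξ : ∀ i, P.map (ξ i) = ν) (hξi : iIndepFun ξ P)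
    (ha : ∀ t, 1 ≤ t → t < N → Measurable[past ξ (k t)] (a t))
    (haT : ∀ t, 1 ≤ t → t < N → ∀ ω, a t ω ∈ T)
    (hw : ∀ t, 1 ≤ t → t < N → Measurable[past ξ (k t)] (w t)) {R : ℝ}
    (hwR : ∀ t, 1 ≤ t → t < N → ∀ ω, ‖w t ω‖ ≤ R) :
    Integrable (fun ω => ∑ t ∈ Finset.Ico 1 N, (t : ℝ) * D (a t ω) (ξ (k t) ω) (w t ω)) P ∧
      ∫ ω, ∑ t ∈ Finset.Ico 1 N, (t : ℝ) * D (a t ω) (ξ (k t) ω) (w t ω) ∂P = 0 := by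
  have h : ∀ t ∈ Finset.Ico 1 N, Integrable (fun ω => D (a t ω) (ξ (k t) ω) (w t ω)) P ∧
      ∫ ω, D (a t ω) (ξ (k t) ω) (w t ω) ∂P = 0 := by
    intro t ht
    obtain ⟨ht1, ht2⟩ := Finset.mem_Ico.1 ht
    exact hD.integral_apply_eq_zero hξm hξ hξi (ha t ht1 ht2) (haT t ht1 ht2) (hw t ht1 ht2)
      (hwR t ht1 ht2)
  refine ⟨integrable_finsetSum _ fun t ht => (h t ht).1.const_mul _, ?_⟩
  rw [integral_finsetSum _ fun t ht => (h t ht).1.const_mul _]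
  refine Finset.sum_eq_zero fun t ht => ?_
  rw [integral_const_mul, (h t ht).2, mul_zero]

/-- The moment generating function of a weighted sum of martingale differences. -/
lemma IsNoise.lintegral_exp_sum_le (hD : IsNoise D T ν σ) (hσ : 0 ≤ σ)
    (hlt : HasLightTail D T ν σ) (hξm : ∀ i, Measurable (ξ i))
    (hξ : ∀ i, P.map (ξ i) = ν) (hξi : iIndepFun ξ P) (hk : StrictMono k)
    (ha : ∀ t, 1 ≤ t → t < N → Measurable[past ξ (k t)] (a t))
    (haT : ∀ t, 1 ≤ t → t < N → ∀ ω, a t ω ∈ T)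
    (hw : ∀ t, 1 ≤ t → t < N → Measurable[past ξ (k t)] (w t)) {R : ℝ}
    (hwR : ∀ t, 1 ≤ t → t < N → ∀ ω, ‖w t ω‖ ≤ R) (s : ℝ) {n : ℕ} (hn1 : 1 ≤ n) (hn : n ≤ N) :
    ∫⁻ ω, ENNReal.ofReal (Real.exp (s * ∑ t ∈ Finset.Ico 1 n,
        (t : ℝ) * D (a t ω) (ξ (k t) ω) (w t ω))) ∂P
      ≤ ENNReal.ofReal (Real.exp (s ^ 2 * (σ * R) ^ 2 * ∑ t ∈ Finset.Ico 1 n, (t : ℝ) ^ 2)) := by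
  have hν : IsProbabilityMeasure ν := by
    rw [← hξ 0]; exact Measure.isProbabilityMeasure_map (hξm 0).aemeasurable
  induction n, hn1 using Nat.le_induction with
  | base => simp
  | succ n hn1 ih =>
    have ih := ih (by omega)
    have hsum : Measurable[past ξ (k n)] fun ω => ∑ t ∈ Finset.Ico 1 n,
        (t : ℝ) * D (a t ω) (ξ (k t) ω) (w t ω) := by
      refine Finset.measurable_sum _ fun t ht => ?_
      obtain ⟨ht1, ht2⟩ := Finset.mem_Ico.1 ht
      have hle : past ξ (k t) ≤ past ξ (k n) := past_mono (hk ht2).le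
      exact (hD.measurable_comp_apply ((ha t ht1 (by omega)).mono hle le_rfl)
        (measurable_past (hk ht2)) ((hw t ht1 (by omega)).mono hle le_rfl)).const_mul _
    have hh : Measurable (Function.uncurry fun (q : ℝ × A × V) z =>
        ENNReal.ofReal (Real.exp (s * q.1)) *
          ENNReal.ofReal (Real.exp (s * n * D q.2.1 z q.2.2))) := by
      have h1 : Measurable fun p : (ℝ × A × V) × Ξ => D p.1.2.1 p.2 p.1.2.2 :=
        hD.measurable_pair.comp (measurable_fst.snd.prodMk measurable_snd)
      have h2 : Measurable fun p : (ℝ × A × V) × Ξ => p.1.1 := measurable_fst.fst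
      exact ((h2.const_mul s).exp.ennreal_ofReal).mul ((h1.const_mul _).exp.ennreal_ofReal)
    -- The partial sum, the query point and the direction all precede sample `k n`. With them
    -- frozen, the last factor is bounded uniformly.
    have hfreeze := lintegral_past hξm hξ hξi
      (hsum.prodMk ((ha n hn1 (by omega)).prodMk (hw n hn1 (by omega)))) hh
    calc _ = ∫⁻ ω, ENNReal.ofReal (Real.exp (s * ∑ t ∈ Finset.Ico 1 n,
            (t : ℝ) * D (a t ω) (ξ (k t) ω) (w t ω))) *
          ENNReal.ofReal (Real.exp (s * n * D (a n ω) (ξ (k n) ω) (w n ω))) ∂P := by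
          refine lintegral_congr fun ω => ?_
          rw [← ENNReal.ofReal_mul (Real.exp_pos _).le, ← Real.exp_add,
            Finset.sum_Ico_succ_top hn1]
          ring_nf
      _ = _ := hfreeze
      _ ≤ ∫⁻ ω, ENNReal.ofReal (Real.exp (s * ∑ t ∈ Finset.Ico 1 n,
            (t : ℝ) * D (a t ω) (ξ (k t) ω) (w t ω))) *
          ENNReal.ofReal (Real.exp ((s * n) ^ 2 * (σ * R) ^ 2)) ∂P := by
          refine lintegral_mono fun ω => ?_
          simp only
          rw [lintegral_const_mul' _ _ ENNReal.ofReal_ne_top]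
          gcongr
          exact hD.lintegral_exp_apply_le hσ hlt (haT n hn1 (by omega) ω)
            (hwR n hn1 (by omega) ω) _
      _ ≤ ENNReal.ofReal (Real.exp (s ^ 2 * (σ * R) ^ 2 * ∑ t ∈ Finset.Ico 1 n, (t : ℝ) ^ 2)) *
          ENNReal.ofReal (Real.exp ((s * n) ^ 2 * (σ * R) ^ 2)) := by
          rw [lintegral_mul_const' _ _ ENNReal.ofReal_ne_top]
          gcongr
      _ = _ := by
          rw [← ENNReal.ofReal_mul (Real.exp_pos _).le, ← Real.exp_add,
            Finset.sum_Ico_succ_top hn1]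
          ring_nf

/-- The large deviation bound for a weighted sum of martingale differences. -/
lemma IsNoise.measureReal_sum_gt_le (hD : IsNoise D T ν σ) (hσ : 0 ≤ σ)
    (hlt : HasLightTail D T ν σ) (hξm : ∀ i, Measurable (ξ i))
    (hξ : ∀ i, P.map (ξ i) = ν) (hξi : iIndepFun ξ P) (hk : StrictMono k)
    (ha : ∀ t, 1 ≤ t → t < N → Measurable[past ξ (k t)] (a t))
    (haT : ∀ t, 1 ≤ t → t < N → ∀ ω, a t ω ∈ T)
    (hw : ∀ t, 1 ≤ t → t < N → Measurable[past ξ (k t)] (w t)) {R : ℝ} (hR : 0 < R)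
    (hwR : ∀ t, 1 ≤ t → t < N → ∀ ω, ‖w t ω‖ ≤ R) (hN : 1 ≤ N) {M : ℝ} (hM : 0 < M)
    (hS : ∑ t ∈ Finset.Ico 1 N, (t : ℝ) ^ 2 ≤ M ^ 2 / 3) {r : ℝ} (hr : 0 < r) :
    P.real {ω | 2 / 3 * r * (σ * R * M) <
        ∑ t ∈ Finset.Ico 1 N, (t : ℝ) * D (a t ω) (ξ (k t) ω) (w t ω)}
      ≤ Real.exp (-r ^ 2 / 3) := by
  rcases hσ.eq_or_lt with rfl | hσ'
  · have h0 : ∀ᵐ ω ∂P, ∀ t ∈ Finset.Ico 1 N, D (a t ω) (ξ (k t) ω) = 0 := by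
      rw [Filter.eventually_all_finset]
      intro t ht
      obtain ⟨ht1, ht2⟩ := Finset.mem_Ico.1 ht
      exact hD.ae_comp_eq_zero hξm hξ hξi (ha t ht1 ht2) (haT t ht1 ht2)
    have : P.real {ω | 2 / 3 * r * (0 * R * M) <
        ∑ t ∈ Finset.Ico 1 N, (t : ℝ) * D (a t ω) (ξ (k t) ω) (w t ω)} = 0 := by
      rw [measureReal_eq_zero_iff]
      refine measure_eq_zero_iff_ae_notMem.2 ?_
      filter_upwards [h0] with ω hω
      rw [Finset.sum_eq_zero fun t ht => by rw [hω t ht]; simp]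
      simp
    rw [this]; exact (Real.exp_pos _).le
  · have hmeas : Measurable fun ω => ∑ t ∈ Finset.Ico 1 N,
        (t : ℝ) * D (a t ω) (ξ (k t) ω) (w t ω) := by
      refine Finset.measurable_sum _ fun t ht => ?_
      obtain ⟨ht1, ht2⟩ := Finset.mem_Ico.1 ht
      have hle := past_le hξm (k t)
      exact (hD.measurable_comp_apply ((ha t ht1 ht2).mono hle le_rfl)
        (hξm _) ((hw t ht1 ht2).mono hle le_rfl)).const_mul _
    have hq : 0 < σ * R * M := by positivity
    -- This minimizes the Chernoff exponent `s² (σRM)² / 3 - s (2/3) r σRM`, with minimum `-r² / 3`.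
    set s : ℝ := r / (σ * R * M) with hs
    have hs0 : 0 < s := by positivity
    have h1 := hD.lintegral_exp_sum_le hσ hlt hξm hξ hξi hk ha haT hw hwR s hN le_rfl
    have h2 := measureReal_exp_le_of_lintegral_exp_le (hmeas.const_mul s) h1
      (b := s * (2 / 3 * r * (σ * R * M)))
    simp only [mul_lt_mul_iff_right₀ hs0] at h2
    refine h2.trans (Real.exp_le_exp.2 ?_)
    have h3 : s * (2 / 3 * r * (σ * R * M)) = 2 / 3 * r ^ 2 := by rw [hs]; field_simp
    have h4 : s ^ 2 * (σ * R) ^ 2 * (M ^ 2 / 3) = r ^ 2 / 3 := by rw [hs]; field_simp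
    have h5 := mul_le_mul_of_nonneg_left hS (by positivity : 0 ≤ s ^ 2 * (σ * R) ^ 2)
    rw [h3]
    linarith

end Deviation

end Noise

/-! ### Centering the oracle -/

section Centered

variable {A V Ξ : Type*} [NormedAddCommGroup V] [NormedSpace ℝ V] [MeasurableSpace Ξ]

/-- The deviation of a random functional from its mean. -/
noncomputable def centered (D : A → Ξ → StrongDual ℝ V) (ν : Measure Ξ) (a : A) (s : Ξ) :
    StrongDual ℝ V :=
  D a s - ∫ z, D a z ∂ν

/-- Subtracting the integral instead of `μ` gives joint measurability for all parameters, while `μ`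
is the mean only on `T` and need not be measurable. -/
lemma isNoise_centered [MeasurableSpace A] [FiniteDimensional ℝ V]
    {D : A → Ξ → StrongDual ℝ V} {T : Set A} {ν : Measure Ξ} [IsProbabilityMeasure ν] {σ : ℝ} {μ : A → StrongDual ℝ V}
    (hD : Measurable (Function.uncurry D)) (hint : ∀ a ∈ T, Integrable (D a) ν)
    (hmean : ∀ a ∈ T, ∫ s, D a s ∂ν = μ a)
    (hvar : ∀ a ∈ T,
      ∫⁻ s, ENNReal.ofReal (‖D a s - μ a‖ ^ 2) ∂ν ≤ ENNReal.ofReal (σ ^ 2)) :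
    IsNoise (centered D ν) T ν σ where
  measurable := by
    have h := hD.stronglyMeasurable.integral_prod_right (ν := ν)
    exact hD.sub (h.measurable.comp measurable_fst)
  integrable a ha := (hint a ha).sub (integrable_const _)
  mean a ha := by
    simp only [centered]
    rw [integral_sub (hint a ha) (integrable_const _)]
    simp
  var a ha := by
    simp only [centered, hmean a ha]
    exact hvar a ha

lemma hasLightTail_centered {D : A → Ξ → StrongDual ℝ V} {T : Set A}
    {ν : Measure Ξ} {σ : ℝ} {μ : A → StrongDual ℝ V}
    (hmean : ∀ a ∈ T, ∫ s, D a s ∂ν = μ a)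
    (htail : ∀ a ∈ T, ∫⁻ s, ENNReal.ofReal (Real.exp (‖μ a - D a s‖ ^ 2 / σ ^ 2)) ∂ν
      ≤ ENNReal.ofReal (Real.exp 1)) :
    HasLightTail (centered D ν) T ν σ := by
  intro a ha
  simp only [centered, hmean a ha]
  simpa only [norm_sub_rev] using htail a ha

end Centered

/-! ### The auxiliary proximal sequences -/

section Auxiliary

variable {V : Type*} [NormedAddCommGroup V] [NormedSpace ℝ V]

lemma IsProxFunction.norm_sub_le {C : Set V} {d : V → ℝ} {α : ℝ} (hd : IsProxFunction C d α)
    {R : ℝ} (hR : 0 < R) (hV : ∀ u ∈ C, ∀ v ∈ C, bregman d u v ≤ R ^ 2) {u v : V} (hu : u ∈ C)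
    (hv : v ∈ C) : ‖u - v‖ ≤ R * √(2 / α) := by
  have hα := hd.modulus_pos
  have h1 := (le_bregman hd.strongConvexOn hv hu (hd.differentiableAt _ hv)).trans (hV u hu v hv)
  refine le_of_sq_le_sq ?_ (by positivity)
  rw [mul_pow, Real.sq_sqrt (by positivity)]
  rw [mul_div_assoc', le_div_iff₀ hα]
  linarith

lemma IsProxFunction.isCompact [FiniteDimensional ℝ V] {C : Set V} (hC : IsClosed C) {d : V → ℝ}
    {α : ℝ} (hd : IsProxFunction C d α) {R : ℝ} (hR : 0 < R)
    (hV : ∀ u ∈ C, ∀ v ∈ C, bregman d u v ≤ R ^ 2) : IsCompact C := by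
  have : ProperSpace V := FiniteDimensional.proper ℝ V
  refine Metric.isCompact_of_isClosed_isBounded hC ?_
  refine Metric.isBounded_iff.2 ⟨R * √(2 / α), fun u hu v hv => ?_⟩
  rw [dist_eq_norm]
  exact hd.norm_sub_le hR hV hu hv

/-- The proximal sequence driven by the functionals `e t`. -/
lemma exists_prox_sequence {Ω : Type*} {C : Set V} (hC : IsCompact C) {d : V → ℝ} {α : ℝ}
    (hd : IsProxFunction C d α) (ρ : ℝ) (e : ℕ → Ω → StrongDual ℝ V) {w₁ : V} (hw₁ : w₁ ∈ C) :
    ∃ w : ℕ → Ω → V, (∀ ω, w 1 ω = w₁) ∧ ∀ t, 1 ≤ t → ∀ ω,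
      IsArgmin C (fun v => e t ω v + ρ * bregman d v (w t ω)) (w (t + 1) ω) := by
  have hex : ∀ (g : StrongDual ℝ V) (u : V), ∃ v,
      IsArgmin C (fun v => g v + ρ * bregman d v u) v := by
    intro g u
    have hcont : ContinuousOn (fun v => g v + ρ * bregman d v u) C := by
      refine g.continuous.continuousOn.add (continuousOn_const.mul ?_)
      exact (hd.continuousOn.sub continuousOn_const).sub (by fun_prop)
    obtain ⟨v, hv, hmin⟩ := hC.exists_isMinOn ⟨w₁, hw₁⟩ hcont
    exact ⟨v, hv, fun v' hv' => hmin hv'⟩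
  choose step hstep using hex
  -- The recursion is shifted to start at time `1`; the value at `0` is never used.
  refine ⟨fun t ω => Nat.rec w₁ (fun n w => step (e (n + 1) ω) w) (t - 1), fun ω => rfl, ?_⟩
  intro t ht ω
  obtain ⟨n, rfl⟩ : ∃ n, t = n + 1 := ⟨t - 1, by omega⟩
  exact hstep _ _

lemma measurable_prox_sequence [FiniteDimensional ℝ V] [MeasurableSpace V] [BorelSpace V]
    {Ω Ξ : Type*} [MeasurableSpace Ξ] {ξ : ℕ → Ω → Ξ} {C : Set V} (hC : Convex ℝ C) {d : V → ℝ}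
    {α : ℝ} (hd : IsProxFunction C d α) {ρ : ℝ} (hρ : 0 < ρ) {e : ℕ → Ω → StrongDual ℝ V} {N : ℕ}
    (he : ∀ t, 1 ≤ t → t < N → Measurable[past ξ (2 * (t + 1))] (e t)) {w₁ : V} (hw₁ : w₁ ∈ C)
    {w : ℕ → Ω → V} (hw1 : ∀ ω, w 1 ω = w₁)
    (hw : ∀ t, 1 ≤ t → ∀ ω,
      IsArgmin C (fun v => e t ω v + ρ * bregman d v (w t ω)) (w (t + 1) ω))
    {t : ℕ} (ht : 1 ≤ t) (htN : t ≤ N) : (∀ ω, w t ω ∈ C) ∧ Measurable[past ξ (2 * t)] (w t) := by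
  induction t, ht using Nat.le_induction with
  | base =>
    refine ⟨fun ω => by rw [hw1]; exact hw₁, ?_⟩
    rw [show w 1 = fun _ => w₁ from funext hw1]
    exact measurable_const
  | succ t ht ih =>
    obtain ⟨ih1, ih2⟩ := ih (by omega)
    refine ⟨fun ω => (hw t ht ω).1, ?_⟩
    exact measurable_prox_step hC hd (J := fun _ => 0) (convexOn_const 0 hC) (he t ht (by omega)) hρ
      (ih2.mono (past_mono (by omega)) le_rfl) ih1 (fun ω => by simpa using hw t ht ω)

end Auxiliary

/-! ### Adaptedness of the iterates -/

section Adapted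

variable {E F Ξ Ω : Type*} [NormedAddCommGroup E] [NormedSpace ℝ E]
  [MeasurableSpace E] [NormedAddCommGroup F] [NormedSpace ℝ F]
  [FiniteDimensional ℝ F] [MeasurableSpace F] [BorelSpace F] [MeasurableSpace Ξ]
  {S : SaddleProblem E F} {dX : E → ℝ} {dY : F → ℝ} {O : Oracle E F Ξ} {ξ : ℕ → Ω → Ξ}
  {N : ℕ} {η τ : ℕ → ℝ} {x₁ : E} {y₁ : F} {x xmd xag xbar : ℕ → Ω → E} {y yag : ℕ → Ω → F}

/-- `y (t + 1)` is a query point of the second oracle call of iteration `t`, so it must be known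
before sample `2 * t + 1`; the past up to `2 * (t + 1)` would be too coarse a statement. -/
lemma IsRun.measurable_y_succ
    (h : IsRun S dX dY O ξ N betaStep thetaStep η τ x₁ y₁ x xmd xag xbar y yag)
    {αY : ℝ} (hdY : IsProxFunction S.Y dY αY)
    (hτ : ∀ t, 1 ≤ t → t < N → 0 < τ t) {t : ℕ} (ht : 1 ≤ t) (htN : t < N)
    (hbar : Measurable[past ξ (2 * t)] (xbar t)) (hy : Measurable[past ξ (2 * t)] (y t)) :
    Measurable[past ξ (2 * t + 1)] (y (t + 1)) := by
  have hle : past ξ (2 * t) ≤ past ξ (2 * t + 1) := past_mono (by omega)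
  refine measurable_prox_step (m := past ξ (2 * t + 1)) S.convex_Y hdY S.convexOn_J
    (g := fun ω => -(O.Kx (xbar t ω) (ξ (2 * t) ω))) ?_
    (one_div_pos.2 (hτ t ht htN)) (hy.mono hle le_rfl)
    (fun ω => h.mem_y ht htN.le ω) (h.y_step t ht htN)
  exact (O.measurable_Kx.comp ((hbar.mono hle le_rfl).prodMk (measurable_past (by omega)))).neg

variable [FiniteDimensional ℝ E] [BorelSpace E]

/-- The iterates at time `t` are functions of the samples with index less than `2 * t`. -/
lemma IsRun.adapted (h : IsRun S dX dY O ξ N betaStep thetaStep η τ x₁ y₁ x xmd xag xbar y yag)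
    {αX αY : ℝ} (hdX : IsProxFunction S.X dX αX) (hdY : IsProxFunction S.Y dY αY)
    (hη : ∀ t, 1 ≤ t → t < N → 0 < η t) (hτ : ∀ t, 1 ≤ t → t < N → 0 < τ t)
    {t : ℕ} (ht : 1 ≤ t) (htN : t ≤ N) :
    Measurable[past ξ (2 * t)] (x t) ∧ Measurable[past ξ (2 * t)] (xag t) ∧
      Measurable[past ξ (2 * t)] (xbar t) ∧ Measurable[past ξ (2 * t)] (y t) ∧
      Measurable[past ξ (2 * t)] (yag t) := by
  induction t, ht using Nat.le_induction with
  | base =>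
    rw [funext h.x_one, funext h.xag_one, funext h.xbar_one, funext h.y_one, funext h.yag_one]
    exact ⟨measurable_const, measurable_const, measurable_const, measurable_const,
      measurable_const⟩
  | succ t ht ih =>
    obtain ⟨ix, iag, ibar, iy, iyag⟩ := ih (by omega)
    have htN' : t < N := htN
    have hle : past ξ (2 * t) ≤ past ξ (2 * (t + 1)) := past_mono (by omega)
    have hy : Measurable[past ξ (2 * (t + 1))] (y (t + 1)) :=
      (h.measurable_y_succ hdY hτ ht htN' ibar iy).mono (past_mono (by omega)) le_rfl
    replace ix := ix.mono hle le_rfl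
    replace iag := iag.mono hle le_rfl
    replace iyag := iyag.mono hle le_rfl
    have hmd : Measurable[past ξ (2 * (t + 1))] (xmd t) := by
      rw [funext (h.md_step t ht htN')]
      exact (iag.const_smul _).add (ix.const_smul _)
    have hξ : Measurable[past ξ (2 * (t + 1))] (ξ (2 * t + 1)) := measurable_past (by omega)
    have hx : Measurable[past ξ (2 * (t + 1))] (x (t + 1)) := by
      refine measurable_prox_step (m := past ξ (2 * (t + 1))) S.convex_X hdX (J := fun _ => 0)
        (convexOn_const 0 S.convex_X)
        (g := fun ω => O.G (xmd t ω) (ξ (2 * t + 1) ω) + O.Ky (y (t + 1) ω) (ξ (2 * t + 1) ω)) ?_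
        (one_div_pos.2 (hη t ht htN')) ix (fun ω => h.mem_x ht htN'.le ω)
        (fun ω => by simpa using h.x_step t ht htN' ω)
      exact (O.measurable_G.comp (hmd.prodMk hξ)).add (O.measurable_Ky.comp (hy.prodMk hξ))
    refine ⟨hx, ?_, ?_, hy, ?_⟩
    · rw [funext (h.xag_step t ht htN')]
      exact (iag.const_smul _).add (hx.const_smul _)
    · rw [funext (h.xbar_step t ht htN')]
      exact ((hx.sub ix).const_smul _).add hx
    · rw [funext (h.yag_step t ht htN')]
      exact (iyag.const_smul _).add (hy.const_smul _)

end Adapted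

/-! ### Numerical constants -/

section Constants

lemma sum_sq_Ico_le {N : ℕ} (hN : 2 ≤ N) :
    ∑ t ∈ Finset.Ico 1 N, (t : ℝ) ^ 2 ≤ ((N : ℝ) * √((N : ℝ) - 1)) ^ 2 / 3 := by
  have key : ∀ n : ℕ, 1 ≤ n → ∑ t ∈ Finset.Ico 1 n, (t : ℝ) ^ 2
      = (n : ℝ) * (n - 1) * (2 * n - 1) / 6 := by
    intro n hn
    induction n, hn using Nat.le_induction with
    | base => simp
    | succ n hn ih =>
      rw [Finset.sum_Ico_succ_top hn, ih]; push_cast; ring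
  have h2 : (2 : ℝ) ≤ N := by exact_mod_cast hN
  rw [key N (by omega), mul_pow, Real.sq_sqrt (by linarith)]
  nlinarith [mul_nonneg (by linarith : (0 : ℝ) ≤ N) (by linarith : (0 : ℝ) ≤ (N : ℝ) - 1)]

lemma half_mul_C₀ (LG LK σx σy DX DY : ℝ) {N : ℕ} (hN : 2 ≤ N) :
    (N : ℝ) * (N - 1) / 2 * C₀ LG LK σx σy DX DY N = 3 * LG * DX ^ 2
      + 3 * LK * DX * DY * (N - 1) + 2 * (N * √((N : ℝ) - 1)) * (σx * DX + σy * DY) := by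
  have h2 : (2 : ℝ) ≤ N := by exact_mod_cast hN
  have hc : (0 : ℝ) < N - 1 := by linarith
  have hs : 0 < √((N : ℝ) - 1) := Real.sqrt_pos.2 hc
  have hsq : (N : ℝ) - 1 = √((N : ℝ) - 1) ^ 2 := (Real.sq_sqrt hc.le).symm
  unfold C₀
  generalize √((N : ℝ) - 1) = q at *
  rw [hsq]
  field_simp
  ring

lemma half_mul_C₁ (σx σy DX DY : ℝ) {N : ℕ} (hN : 2 ≤ N) :
    (N : ℝ) * (N - 1) / 2 * C₁ σx σy DX DY N
      = 3 / 2 * (N * √((N : ℝ) - 1)) * (σx * DX + σy * DY) := by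
  have h2 : (2 : ℝ) ≤ N := by exact_mod_cast hN
  have hc : (0 : ℝ) < N - 1 := by linarith
  have hs : 0 < √((N : ℝ) - 1) := Real.sqrt_pos.2 hc
  have hsq : (N : ℝ) - 1 = √((N : ℝ) - 1) ^ 2 := (Real.sq_sqrt hc.le).symm
  unfold C₁
  generalize √((N : ℝ) - 1) = q at *
  rw [hsq]
  field_simp

/-- The contribution of the squared noise when the quadratic coefficient `r` is large enough. -/
lemma sq_mul_div_le {s S M D r : ℝ} (hs : 0 ≤ s) (hM : 0 < M) (hD : 0 < D) (hr : 0 < r)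
    (hS : S ≤ M ^ 2 / 3) (hrs : 3 / 4 * s * M / D ≤ r) : s ^ 2 * S / r ≤ 4 / 9 * (s * D * M) := by
  rw [div_le_iff₀ hr]
  calc s ^ 2 * S ≤ s ^ 2 * (M ^ 2 / 3) := by gcongr
    _ = 4 / 9 * (s * D * M) * (3 / 4 * s * M / D) := by field_simp; norm_num
    _ ≤ _ := by gcongr

/-- The noise contribution of one iteration, split according to the three oracle outputs. -/
lemma noise_terms_le {E F : Type*} [NormedAddCommGroup E] [NormedSpace ℝ E]
    [NormedAddCommGroup F] [NormedSpace ℝ F] (δ₁ δ₂ : StrongDual ℝ E) (δ : StrongDual ℝ F)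
    (p q : E) (v : F) (t : ℝ) {r : ℝ} (hr : 0 < r) (r' : ℝ) :
    ‖(-t) • (δ₁ + δ₂)‖ ^ 2 / (2 * r) + ((-t) • (δ₁ + δ₂)) (p - q) + ‖t • δ‖ ^ 2 / (2 * r')
        + (t • δ) v
      ≤ t * δ₁ (q - p) + t * δ₂ (q - p) + t * δ v
        + ((t ^ 2 * ‖δ₁‖ ^ 2 / r + t ^ 2 * ‖δ₂‖ ^ 2 / r) + t ^ 2 * ‖δ‖ ^ 2 / (2 * r')) := by
  have h1 : ‖δ₁ + δ₂‖ ^ 2 ≤ 2 * (‖δ₁‖ ^ 2 + ‖δ₂‖ ^ 2) := by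
    have := pow_le_pow_left₀ (norm_nonneg _) (norm_add_le δ₁ δ₂) 2
    nlinarith [sq_nonneg (‖δ₁‖ - ‖δ₂‖)]
  have h2 : ‖(-t) • (δ₁ + δ₂)‖ ^ 2 / (2 * r) ≤ t ^ 2 * ‖δ₁‖ ^ 2 / r + t ^ 2 * ‖δ₂‖ ^ 2 / r := by
    have h3 : t ^ 2 * ‖δ₁‖ ^ 2 / r + t ^ 2 * ‖δ₂‖ ^ 2 / r
        = t ^ 2 * (2 * (‖δ₁‖ ^ 2 + ‖δ₂‖ ^ 2)) / (2 * r) := by field_simp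
    rw [h3, norm_smul, mul_pow, norm_neg, Real.norm_eq_abs, sq_abs]
    gcongr
  have h4 : ‖t • δ‖ ^ 2 = t ^ 2 * ‖δ‖ ^ 2 := by
    rw [norm_smul, mul_pow, Real.norm_eq_abs, sq_abs]
  rw [h4]
  simp only [smul_apply, add_apply, smul_eq_mul, map_sub]
  linarith

/-- The sharp factor is `√2`; `3 / 2` cancels the `2 / 3` in the martingale threshold when the two
noises of the `x` step are merged into `σx`. -/
lemma add_le_mul_sqrt (a b : ℝ) : a + b ≤ 3 / 2 * √(a ^ 2 + b ^ 2) := by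
  have h := Real.sqrt_nonneg (a ^ 2 + b ^ 2)
  refine le_of_sq_le_sq ?_ (by positivity)
  rw [mul_pow, Real.sq_sqrt (by positivity)]
  nlinarith [sq_nonneg (a - b), sq_nonneg (a + b)]

end Constants

end StochAPD

/-! ### The main theorem -/

set_option maxHeartbeats 1600000 in
theorem corollary3p1
    {E F Ξ Ω : Type*}
    [NormedAddCommGroup E] [NormedSpace ℝ E] [FiniteDimensional ℝ E]
    [MeasurableSpace E] [BorelSpace E]
    [NormedAddCommGroup F] [NormedSpace ℝ F] [FiniteDimensional ℝ F]
    [MeasurableSpace F] [BorelSpace F]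
    [MeasurableSpace Ξ] [MeasurableSpace Ω]
    (P : Measure Ω) [IsProbabilityMeasure P]
    (S : StochAPD.SaddleProblem E F)
    -- the distance generating functions and the bounds on the Bregman divergences
    (dX : E → ℝ) (dY : F → ℝ) (αX αY : ℝ)
    (hdX : StochAPD.IsProxFunction S.X dX αX) (hdY : StochAPD.IsProxFunction S.Y dY αY)
    (ΩX ΩY : ℝ) (hΩX : 0 < ΩX) (hΩY : 0 < ΩY)
    (hVX : ∀ x ∈ S.X, ∀ x' ∈ S.X, StochAPD.bregman dX x x' ≤ ΩX ^ 2)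
    (hVY : ∀ y ∈ S.Y, ∀ y' ∈ S.Y, StochAPD.bregman dY y y' ≤ ΩY ^ 2)
    (DX DY : ℝ) (hDX : DX = ΩX * √(2 / αX)) (hDY : DY = ΩY * √(2 / αY))
    -- the oracle and its i.i.d. samples with common law `ν`
    (O : StochAPD.Oracle E F Ξ) (ν : Measure Ξ) (ξ : ℕ → Ω → Ξ)
    (hξm : ∀ i, Measurable (ξ i)) (hξ : ∀ i, P.map (ξ i) = ν) (hξi : iIndepFun ξ P)
    (hO : O.IsUnbiased S ν)
    (σxG σxK σy σx : ℝ) (hσxG : 0 ≤ σxG) (hσxK : 0 ≤ σxK) (hσy : 0 ≤ σy)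
    (hσx : σx = √(σxG ^ 2 + σxK ^ 2))
    (hA1 : O.BoundedVariance S ν σxG σy σxK)
    -- the number of iterations, and that the denominators of the stepsizes do not vanish
    (N : ℕ) (hN : 2 ≤ N)
    (hη : 0 < S.LG ∨ 0 < ‖S.K‖ ∨ 0 < σx) (hτ : 0 < ‖S.K‖ ∨ 0 < σy)
    -- the run of the method
    (x₁ : E) (y₁ : F) (x xmd xag xbar : ℕ → Ω → E) (y yag : ℕ → Ω → F)
    (hrun : StochAPD.IsRun S dX dY O ξ N
      StochAPD.betaStep StochAPD.thetaStep
      (StochAPD.etaStep αX S.LG ‖S.K‖ σx DX DY N) (StochAPD.tauStep αY ‖S.K‖ σy DX DY N)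
      x₁ y₁ x xmd xag xbar y yag) :
    (Integrable (fun ω => S.gap (xag N ω, yag N ω)) P ∧
      ∫ ω, S.gap (xag N ω, yag N ω) ∂P ≤ StochAPD.C₀ S.LG ‖S.K‖ σx σy DX DY N) ∧
    (O.LightTail S ν σxG σy σxK → ∀ r : ℝ, 0 < r →
      P.real {ω | StochAPD.C₀ S.LG ‖S.K‖ σx σy DX DY N + r * StochAPD.C₁ σx σy DX DY N
          < S.gap (xag N ω, yag N ω)}
        ≤ 3 * Real.exp (-r ^ 2 / 3) + 3 * Real.exp (-r)) := by
  have hν : IsProbabilityMeasure ν := by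
    rw [← hξ 0]; exact Measure.isProbabilityMeasure_map (hξm 0).aemeasurable
  have hαX := hdX.modulus_pos
  have hαY := hdY.modulus_pos
  have hDX0 : 0 < DX := by rw [hDX]; positivity
  have hDY0 : 0 < DY := by rw [hDY]; positivity
  have hDXsq : αX * DX ^ 2 = 2 * ΩX ^ 2 := by
    rw [hDX, mul_pow, Real.sq_sqrt (by positivity)]; field_simp
  have hDYsq : αY * DY ^ 2 = 2 * ΩY ^ 2 := by
    rw [hDY, mul_pow, Real.sq_sqrt (by positivity)]; field_simp
  have hσx0 : 0 ≤ σx := by rw [hσx]; positivity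
  have hσxsq : σx ^ 2 = σxG ^ 2 + σxK ^ 2 := by rw [hσx]; exact Real.sq_sqrt (by positivity)
  have hN2 : (2 : ℝ) ≤ N := by exact_mod_cast hN
  obtain ⟨c, hc⟩ : ∃ c : ℝ, c = (N : ℝ) - 1 := ⟨_, rfl⟩
  have hc0 : 0 < c := by linarith
  obtain ⟨M, hM⟩ : ∃ M : ℝ, M = N * √((N : ℝ) - 1) := ⟨_, rfl⟩
  have hM0 : 0 < M := by
    rw [hM, ← hc]; positivity
  obtain ⟨LK, hLK⟩ : ∃ LK : ℝ, LK = ‖S.K‖ := ⟨_, rfl⟩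
  have hLK0 : 0 ≤ LK := by rw [hLK]; positivity
  have hLG0 := S.LG_nonneg
  have hS := StochAPD.sum_sq_Ico_le hN
  rw [← hM] at hS
  obtain ⟨sq, hsq⟩ : ∃ sq : ℝ, sq = ∑ t ∈ Finset.Ico 1 N, (t : ℝ) ^ 2 := ⟨_, rfl⟩
  -- the constants of the pathwise estimate
  obtain ⟨cx, hcx⟩ : ∃ cx : ℝ, cx = 6 * S.LG * DX + 3 * LK * DY * c + 3 * σx * M := ⟨_, rfl⟩
  obtain ⟨cy, hcy⟩ : ∃ cy : ℝ, cy = 3 * LK * DX * c + 3 * σy * M := ⟨_, rfl⟩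
  have hcx0 : 0 < cx := by
    have h1 : 0 ≤ 6 * S.LG * DX := by positivity
    have h2 : 0 ≤ 3 * LK * DY * c := by positivity
    have h3 : 0 ≤ 3 * σx * M := by positivity
    rcases hη with h | h | h
    · have : 0 < 6 * S.LG * DX := by positivity
      linarith
    · rw [← hLK] at h
      have : 0 < 3 * LK * DY * c := by positivity
      linarith
    · have : 0 < 3 * σx * M := by positivity
      linarith
  have hcy0 : 0 < cy := by
    have h2 : 0 ≤ 3 * LK * DX * c := by positivity
    have h3 : 0 ≤ 3 * σy * M := by positivity
    rcases hτ with h | h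
    · rw [← hLK] at h
      have : 0 < 3 * LK * DX * c := by positivity
      linarith
    · have : 0 < 3 * σy * M := by positivity
      linarith
  have hηt : ∀ t : ℕ, StochAPD.etaStep αX S.LG ‖S.K‖ σx DX DY N t = 2 * αX * DX * t / cx := by
    intro t
    rw [hcx, hM, hLK, hc, StochAPD.etaStep, ← mul_assoc]
  have hτt : ∀ t : ℕ, StochAPD.tauStep αY ‖S.K‖ σy DX DY N t = 2 * αY * DY * t / cy := by
    intro t
    rw [hcy, hM, hLK, hc, StochAPD.tauStep, ← mul_assoc]
  have ht0 : ∀ t : ℕ, 1 ≤ t → (0 : ℝ) < t := fun t ht => by exact_mod_cast ht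
  have hη0 : ∀ t, 1 ≤ t → t < N → 0 < StochAPD.etaStep αX S.LG ‖S.K‖ σx DX DY N t := by
    intro t ht _
    have := ht0 t ht
    rw [hηt]; positivity
  have hτ0 : ∀ t, 1 ≤ t → t < N → 0 < StochAPD.tauStep αY ‖S.K‖ σy DX DY N t := by
    intro t ht _
    have := ht0 t ht
    rw [hτt]; positivity
  obtain ⟨px, hpx⟩ : ∃ px : ℝ, px = cx / (2 * αX * DX) := ⟨_, rfl⟩
  obtain ⟨py, hpy⟩ : ∃ py : ℝ, py = cy / (2 * αY * DY) := ⟨_, rfl⟩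
  have hpx0 : 0 < px := by rw [hpx]; positivity
  have hpy0 : 0 < py := by rw [hpy]; positivity
  -- `rx` is what `px * (αX / 2)` leaves for the noise after `S.LG` and the bilinear share `LK * c *
  -- DY / DX / 2` are paid; `ry` likewise, without a smoothness cost.
  obtain ⟨rx, hrx⟩ : ∃ rx : ℝ, rx = S.LG / 2 + LK * c * DY / DX / 4 + 3 / 4 * σx * M / DX :=
    ⟨_, rfl⟩
  obtain ⟨ry, hry⟩ : ∃ ry : ℝ, ry = LK * c * DX / DY / 4 + 3 / 4 * σy * M / DY := ⟨_, rfl⟩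
  have hrx1 : 3 / 4 * σx * M / DX ≤ rx := by
    have : 0 ≤ S.LG / 2 + LK * c * DY / DX / 4 := by positivity
    linarith
  have hry1 : 3 / 4 * σy * M / DY ≤ ry := by
    have : 0 ≤ LK * c * DX / DY / 4 := by positivity
    linarith
  have hrx0 : 0 < rx := by
    have : cx / (12 * DX) ≤ rx := by
      have h1 : cx / (12 * DX) = S.LG / 2 + LK * c * DY / DX / 4 + 1 / 4 * σx * M / DX := by
        rw [hcx]; field_simp; ring
      have h2 : 1 / 4 * σx * M / DX ≤ 3 / 4 * σx * M / DX := by gcongr; norm_num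
      linarith
    exact lt_of_lt_of_le (by positivity) this
  have hry0 : 0 < ry := by
    have : cy / (12 * DY) ≤ ry := by
      have h1 : cy / (12 * DY) = LK * c * DX / DY / 4 + 1 / 4 * σy * M / DY := by
        rw [hcy]; field_simp; ring
      have h2 : 1 / 4 * σy * M / DY ≤ 3 / 4 * σy * M / DY := by gcongr; norm_num
      linarith
    exact lt_of_lt_of_le (by positivity) this
  -- the noise
  have nG : StochAPD.IsNoise (StochAPD.centered O.G ν) S.X ν σxG :=
    StochAPD.isNoise_centered O.measurable_G hO.integrable_G hO.mean_G hA1.var_G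
  have nKx : StochAPD.IsNoise (StochAPD.centered O.Kx ν) S.extrapolated ν σy :=
    StochAPD.isNoise_centered O.measurable_Kx hO.integrable_Kx hO.mean_Kx hA1.var_Kx
  have nKy : StochAPD.IsNoise (StochAPD.centered O.Ky ν) S.Y ν σxK :=
    StochAPD.isNoise_centered O.measurable_Ky hO.integrable_Ky hO.mean_Ky hA1.var_Ky
  let δG : ℕ → Ω → StrongDual ℝ E := fun t ω =>
    StochAPD.centered O.G ν (xmd t ω) (ξ (2 * t + 1) ω)
  let δK : ℕ → Ω → StrongDual ℝ E := fun t ω =>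
    StochAPD.centered O.Ky ν (y (t + 1) ω) (ξ (2 * t + 1) ω)
  let δy : ℕ → Ω → StrongDual ℝ F := fun t ω =>
    StochAPD.centered O.Kx ν (xbar t ω) (ξ (2 * t) ω)
  let ex : ℕ → Ω → StrongDual ℝ E := fun t ω => (-(t : ℝ)) • (δG t ω + δK t ω)
  let ey : ℕ → Ω → StrongDual ℝ F := fun t ω => (t : ℝ) • δy t ω
  -- the iterates are adapted
  have hN1 : 1 ≤ N := by omega
  have had := fun (t : ℕ) (ht : 1 ≤ t) (htN : t ≤ N) => hrun.adapted hdX hdY hη0 hτ0 ht htN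
  have hle1 : ∀ t, StochAPD.past ξ (2 * t) ≤ StochAPD.past ξ (2 * t + 1) :=
    fun t => StochAPD.past_mono (by omega)
  have hy1 : ∀ t, 1 ≤ t → t < N → Measurable[StochAPD.past ξ (2 * t + 1)] (y (t + 1)) :=
    fun t ht htN => hrun.measurable_y_succ hdY hτ0 ht htN (had t ht htN.le).2.2.1
      (had t ht htN.le).2.2.2.1
  have hmd1 : ∀ t, 1 ≤ t → t < N → Measurable[StochAPD.past ξ (2 * t + 1)] (xmd t) := by
    intro t ht htN
    obtain ⟨h1, h2, -⟩ := had t ht htN.le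
    rw [funext (hrun.md_step t ht htN)]
    exact ((h2.mono (hle1 t) le_rfl).const_smul _).add ((h1.mono (hle1 t) le_rfl).const_smul _)
  have hmem_md : ∀ t, 1 ≤ t → t < N → ∀ ω, xmd t ω ∈ S.X :=
    fun t ht htN ω => hrun.mem_xmd ht htN ω
  have hmem_y1 : ∀ t, 1 ≤ t → t < N → ∀ ω, y (t + 1) ω ∈ S.Y :=
    fun t ht htN ω => hrun.mem_y (by omega) htN ω
  have hmem_bar : ∀ t, 1 ≤ t → t < N → ∀ ω, xbar t ω ∈ S.extrapolated :=
    fun t ht htN ω => hrun.mem_xbar ht htN.le ω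
  have hex : ∀ t, 1 ≤ t → t < N → Measurable[StochAPD.past ξ (2 * (t + 1))] (ex t) := by
    intro t ht htN
    have hle : StochAPD.past ξ (2 * t + 1) ≤ StochAPD.past ξ (2 * (t + 1)) :=
      StochAPD.past_mono (by omega)
    have hξ' : Measurable[StochAPD.past ξ (2 * (t + 1))] (ξ (2 * t + 1)) :=
      StochAPD.measurable_past (by omega)
    have h1 := (nG.measurable_comp ((hmd1 t ht htN).mono hle le_rfl) hξ').add
      (nKy.measurable_comp ((hy1 t ht htN).mono hle le_rfl) hξ')
    exact h1.const_smul (-(t : ℝ))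
  have hey : ∀ t, 1 ≤ t → t < N → Measurable[StochAPD.past ξ (2 * (t + 1))] (ey t) := by
    intro t ht htN
    have hle : StochAPD.past ξ (2 * t) ≤ StochAPD.past ξ (2 * (t + 1)) :=
      StochAPD.past_mono (by omega)
    have hξ' : Measurable[StochAPD.past ξ (2 * (t + 1))] (ξ (2 * t)) :=
      StochAPD.measurable_past (by omega)
    have h1 := nKx.measurable_comp ((had t ht htN.le).2.2.1.mono hle le_rfl) hξ'
    exact h1.const_smul (t : ℝ)
  -- the auxiliary sequences
  obtain ⟨wx, hwx1, hwx⟩ := StochAPD.exists_prox_sequence (hdX.isCompact S.isClosed_X hΩX hVX) hdX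
    px ex hrun.x₁_mem
  obtain ⟨wy, hwy1, hwy⟩ := StochAPD.exists_prox_sequence (hdY.isCompact S.isClosed_Y hΩY hVY) hdY
    py ey hrun.y₁_mem
  have hwxm := fun (t : ℕ) (ht : 1 ≤ t) (htN : t ≤ N) => StochAPD.measurable_prox_sequence
    S.convex_X hdX hpx0 hex hrun.x₁_mem hwx1 hwx ht htN
  have hwym := fun (t : ℕ) (ht : 1 ≤ t) (htN : t ≤ N) => StochAPD.measurable_prox_sequence
    S.convex_Y hdY hpy0 hey hrun.y₁_mem hwy1 hwy ht htN
  -- The order is opposite to that in `vy` because `ex` carries a minus sign.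
  let vx : ℕ → Ω → E := fun t ω => wx t ω - x t ω
  let vy : ℕ → Ω → F := fun t ω => y t ω - wy t ω
  have hvx : ∀ t, 1 ≤ t → t < N → Measurable[StochAPD.past ξ (2 * t + 1)] (vx t) :=
    fun t ht htN => ((hwxm t ht htN.le).2.sub (had t ht htN.le).1).mono (hle1 t) le_rfl
  have hvy : ∀ t, 1 ≤ t → t < N → Measurable[StochAPD.past ξ (2 * t)] (vy t) :=
    fun t ht htN => (had t ht htN.le).2.2.2.1.sub (hwym t ht htN.le).2
  have hvxR : ∀ t, 1 ≤ t → t < N → ∀ ω, ‖vx t ω‖ ≤ DX := fun t ht htN ω => by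
    rw [hDX]
    exact hdX.norm_sub_le hΩX hVX ((hwxm t ht htN.le).1 ω) (hrun.mem_x ht htN.le ω)
  have hvyR : ∀ t, 1 ≤ t → t < N → ∀ ω, ‖vy t ω‖ ≤ DY := fun t ht htN ω => by
    rw [hDY]
    exact hdY.norm_sub_le hΩY hVY (hrun.mem_y ht htN.le ω) ((hwym t ht htN.le).1 ω)
  -- the pathwise bound
  let mG : Ω → ℝ := fun ω => ∑ t ∈ Finset.Ico 1 N, (t : ℝ) * δG t ω (vx t ω)
  let mK : Ω → ℝ := fun ω => ∑ t ∈ Finset.Ico 1 N, (t : ℝ) * δK t ω (vx t ω)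
  let my : Ω → ℝ := fun ω => ∑ t ∈ Finset.Ico 1 N, (t : ℝ) * δy t ω (vy t ω)
  let qG : Ω → ℝ := fun ω => ∑ t ∈ Finset.Ico 1 N, (t : ℝ) ^ 2 * ‖δG t ω‖ ^ 2
  let qK : Ω → ℝ := fun ω => ∑ t ∈ Finset.Ico 1 N, (t : ℝ) ^ 2 * ‖δK t ω‖ ^ 2
  let qy : Ω → ℝ := fun ω => ∑ t ∈ Finset.Ico 1 N, (t : ℝ) ^ 2 * ‖δy t ω‖ ^ 2
  let B : Ω → ℝ := fun ω => cx * DX / 2 + cy * DY / 2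
    + (mG ω + mK ω + my ω + ((qG ω + qK ω) / rx + qy ω / (2 * ry)))
  have hQ : ∀ ω, ∀ z ∈ S.X ×ˢ S.Y,
      (N : ℝ) * (N - 1) / 2 * S.Q (xag N ω, yag N ω) z ≤ B ω := by
    rintro ω ⟨u, v⟩ ⟨hu, hv⟩
    have h1 := hrun.weighted_Q_le hN1 hdX hdY (px := px) (py := py)
      (a := LK * c * DY / DX / 2) (b := LK * c * DX / DY / 2) (rx := rx) (ry := ry)
      hpx0 hpy0 hrx0 hry0
      (fun t ht _ => by
        have := ht0 t ht
        rw [hηt, hpx]; field_simp)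
      (fun t ht _ => by
        have := ht0 t ht
        rw [hτt, hpy]; field_simp)
      (by positivity) (by positivity)
      (le_of_eq (by rw [hrx, hpx, hcx]; field_simp; ring))
      (le_of_eq (by rw [hry, hpy, hcy]; field_simp; ring))
      (fun p q hp hq => by
        rw [← hc, ← hLK]
        have h1 : 0 ≤ LK * c / (2 * DX * DY) * (DY * p - DX * q) ^ 2 := by positivity
        have h2 : LK * c / (2 * DX * DY) * (DY * p - DX * q) ^ 2
            = LK * c * DY / DX / 2 * p ^ 2 + LK * c * DX / DY / 2 * q ^ 2 - c * (LK * p * q) := by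
          field_simp; ring
        linarith)
      ω (wx := fun t => wx t ω) (wy := fun t => wy t ω) (ex := fun t => ex t ω)
      (ey := fun t => ey t ω)
      (fun t ht htN => by
        simp only [ex, δG, δK, StochAPD.centered, hO.mean_G _ (hmem_md t ht htN ω),
          hO.mean_Ky _ (hmem_y1 t ht htN ω)]
        congr 1; abel)
      (fun t ht htN => by
        simp only [ey, δy, StochAPD.centered, hO.mean_Kx _ (hmem_bar t ht htN ω)])
      (by rw [hwx1]; exact hrun.x₁_mem) (by rw [hwy1]; exact hrun.y₁_mem)
      (fun t ht _ => hwx t ht ω) (fun t ht _ => hwy t ht ω) hu hv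
    simp only [hwx1, hwy1] at h1
    refine h1.trans ?_
    -- The run and the auxiliary sequence both start at `x₁`, whence two equal divergences and `2 *
    -- ΩX ^ 2 = αX * DX ^ 2`.
    have h2 : px * (StochAPD.bregman dX u x₁ + StochAPD.bregman dX u x₁) ≤ cx * DX / 2 := by
      have h3 := hVX u hu x₁ hrun.x₁_mem
      calc _ ≤ px * (ΩX ^ 2 + ΩX ^ 2) := by gcongr
        _ = px * (αX * DX ^ 2) := by rw [hDXsq]; ring
        _ = _ := by rw [hpx]; field_simp
    have h3 : py * (StochAPD.bregman dY v y₁ + StochAPD.bregman dY v y₁) ≤ cy * DY / 2 := by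
      have h3 := hVY v hv y₁ hrun.y₁_mem
      calc _ ≤ py * (ΩY ^ 2 + ΩY ^ 2) := by gcongr
        _ = py * (αY * DY ^ 2) := by rw [hDYsq]; ring
        _ = _ := by rw [hpy]; field_simp
    refine add_le_add (add_le_add h2 h3) ?_
    simp only [mG, mK, my, qG, qK, qy]
    rw [← Finset.sum_add_distrib, ← Finset.sum_add_distrib, ← Finset.sum_add_distrib,
      Finset.sum_div, Finset.sum_div, ← Finset.sum_add_distrib, ← Finset.sum_add_distrib]
    refine Finset.sum_le_sum fun t _ => ?_
    have h4 := StochAPD.noise_terms_le (δG t ω) (δK t ω) (δy t ω) (x t ω) (wx t ω) (vy t ω) t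
      hrx0 ry
    rw [← add_div] at h4
    exact h4
  have hκ : 0 < (N : ℝ) * (N - 1) / 2 := by rw [← hc]; positivity
  have hQ' : ∀ ω, ∀ z ∈ S.X ×ˢ S.Y,
      S.Q (xag N ω, yag N ω) z ≤ B ω / ((N : ℝ) * (N - 1) / 2) :=
    fun ω z hz => (le_div_iff₀' hκ).2 (hQ ω z hz)
  have hagX := fun ω => hrun.mem_xag hN1 le_rfl ω
  have hagY := fun ω => hrun.mem_yag hN1 le_rfl ω
  have hbdd : ∀ ω, BddAbove ((fun z => S.Q (xag N ω, yag N ω) z) '' (S.X ×ˢ S.Y)) := by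
    refine fun ω => ⟨B ω / ((N : ℝ) * (N - 1) / 2), ?_⟩
    rintro _ ⟨z, hz, rfl⟩
    exact hQ' ω z hz
  have hgapB : ∀ ω, S.gap (xag N ω, yag N ω) ≤ B ω / ((N : ℝ) * (N - 1) / 2) := by
    intro ω
    refine csSup_le ⟨_, (xag N ω, yag N ω), ⟨hagX ω, hagY ω⟩, rfl⟩ ?_
    rintro _ ⟨z, hz, rfl⟩
    exact hQ' ω z hz
  have hgap0 : ∀ ω, 0 ≤ S.gap (xag N ω, yag N ω) := by
    intro ω
    refine le_csSup (hbdd ω) ⟨(xag N ω, yag N ω), ⟨hagX ω, hagY ω⟩, ?_⟩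
    simp [StochAPD.SaddleProblem.Q]
  have hgapm : Measurable fun ω => S.gap (xag N ω, yag N ω) :=
    S.measurable_gap ((had N hN1 le_rfl).2.1.mono (StochAPD.past_le hξm _) le_rfl)
      ((had N hN1 le_rfl).2.2.2.2.mono (StochAPD.past_le hξm _) le_rfl) hagX hagY hbdd
  -- the contribution of the squared noise
  have hBx : (σxG ^ 2 * sq + σxK ^ 2 * sq) / rx ≤ 4 / 9 * (σx * DX * M) := by
    rw [← add_mul, ← hσxsq]
    exact StochAPD.sq_mul_div_le hσx0 hM0 hDX0 hrx0 (hsq ▸ hS) hrx1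
  have hBy : σy ^ 2 * sq / (2 * ry) ≤ 2 / 9 * (σy * DY * M) := by
    have h1 := StochAPD.sq_mul_div_le hσy hM0 hDY0 hry0 (hsq ▸ hS) hry1
    have h2 : σy ^ 2 * sq / (2 * ry) = σy ^ 2 * sq / ry / 2 := by field_simp
    rw [h2]; linarith
  -- The noise coefficient here is `3 / 2`, while the weighted `C₀` allows `2`. The remaining `1 /
  -- 2` covers the squared noise, which costs `4 / 9` and `2 / 9`.
  have hdet : cx * DX / 2 + cy * DY / 2 = 3 * S.LG * DX ^ 2 + 3 * LK * DX * DY * c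
      + 3 / 2 * M * (σx * DX + σy * DY) := by
    rw [hcx, hcy]; ring
  have hC0 := StochAPD.half_mul_C₀ S.LG ‖S.K‖ σx σy DX DY hN
  have hC1 := StochAPD.half_mul_C₁ σx σy DX DY hN
  rw [← hM, ← hc, ← hLK] at hC0
  rw [← hM, ← hc] at hC1
  rw [← hc] at hκ hgapB
  have hpX : 0 ≤ σx * DX * M := by positivity
  have hpY : 0 ≤ σy * DY * M := by positivity
  refine ⟨?_, ?_⟩
  · -- the expectation
    have i1 := nG.integral_sum_eq_zero (k := fun t => 2 * t + 1) hξm hξ hξi hmd1 hmem_md hvx hvxR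
    have i2 := nKy.integral_sum_eq_zero (k := fun t => 2 * t + 1) (a := fun t => y (t + 1))
      hξm hξ hξi hy1 hmem_y1 hvx hvxR
    have i3 := nKx.integral_sum_eq_zero (k := fun t => 2 * t) hξm hξ hξi
      (fun t ht htN => (had t ht htN.le).2.2.1) hmem_bar hvy hvyR
    have i4 := nG.integrable_sum_sq (k := fun t => 2 * t + 1) hξm hξ hξi hmd1 hmem_md
    have i5 := nKy.integrable_sum_sq (k := fun t => 2 * t + 1) (a := fun t => y (t + 1))
      hξm hξ hξi hy1 hmem_y1
    have i6 := nKx.integrable_sum_sq (k := fun t => 2 * t) hξm hξ hξi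
      (fun t ht htN => (had t ht htN.le).2.2.1) hmem_bar
    rw [← hsq] at i4 i5 i6
    change Integrable mG P ∧ ∫ ω, mG ω ∂P = 0 at i1
    change Integrable mK P ∧ ∫ ω, mK ω ∂P = 0 at i2
    change Integrable my P ∧ ∫ ω, my ω ∂P = 0 at i3
    change Integrable qG P ∧ ∫ ω, qG ω ∂P ≤ _ at i4
    change Integrable qK P ∧ ∫ ω, qK ω ∂P ≤ _ at i5
    change Integrable qy P ∧ ∫ ω, qy ω ∂P ≤ _ at i6
    have j1 : Integrable (fun ω => mG ω + mK ω) P := i1.1.add i2.1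
    have j2 : Integrable (fun ω => mG ω + mK ω + my ω) P := j1.add i3.1
    have j3 : Integrable (fun ω => qG ω + qK ω) P := i4.1.add i5.1
    have j4 : Integrable (fun ω => (qG ω + qK ω) / rx) P := j3.div_const _
    have j5 : Integrable (fun ω => qy ω / (2 * ry)) P := i6.1.div_const _
    have j6 : Integrable (fun ω => (qG ω + qK ω) / rx + qy ω / (2 * ry)) P := j4.add j5
    have j7 : Integrable (fun ω => mG ω + mK ω + my ω
      + ((qG ω + qK ω) / rx + qy ω / (2 * ry))) P := j2.add j6
    have jB : Integrable B P := (integrable_const _).add j7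
    have hgapi : Integrable (fun ω => S.gap (xag N ω, yag N ω)) P := by
      refine (jB.div_const ((N : ℝ) * c / 2)).mono' hgapm.aestronglyMeasurable
        (Eventually.of_forall fun ω => ?_)
      rw [Real.norm_of_nonneg (hgap0 ω)]
      exact hgapB ω
    refine ⟨hgapi, ?_⟩
    have hint : ∫ ω, S.gap (xag N ω, yag N ω) ∂P ≤ (∫ ω, B ω ∂P) / ((N : ℝ) * c / 2) := by
      rw [← integral_div]
      exact integral_mono hgapi (jB.div_const _) hgapB
    have hBint : ∫ ω, B ω ∂P = cx * DX / 2 + cy * DY / 2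
        + ((∫ ω, qG ω ∂P + ∫ ω, qK ω ∂P) / rx + (∫ ω, qy ω ∂P) / (2 * ry)) := by
      simp only [B]
      rw [integral_add (integrable_const _) j7, integral_add j2 j6, integral_add j4 j5,
        integral_add j1 i3.1, integral_add i1.1 i2.1, integral_div, integral_div,
        integral_add i4.1 i5.1, i1.2, i2.2, i3.2]
      simp
    have h1 : (∫ ω, qG ω ∂P + ∫ ω, qK ω ∂P) / rx ≤ 4 / 9 * (σx * DX * M) :=
      le_trans (div_le_div_of_nonneg_right (add_le_add i4.2 i5.2) hrx0.le) hBx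
    have h2 : (∫ ω, qy ω ∂P) / (2 * ry) ≤ 2 / 9 * (σy * DY * M) :=
      le_trans (div_le_div_of_nonneg_right i6.2 (by positivity)) hBy
    refine hint.trans ((div_le_iff₀' hκ).2 ?_)
    rw [hBint, ← hLK, hC0]
    linarith
  · -- the tail
    intro hA2 r hr
    have lG : StochAPD.HasLightTail (StochAPD.centered O.G ν) S.X ν σxG :=
      StochAPD.hasLightTail_centered hO.mean_G hA2.tail_G
    have lKx : StochAPD.HasLightTail (StochAPD.centered O.Kx ν) S.extrapolated ν σy :=
      StochAPD.hasLightTail_centered hO.mean_Kx hA2.tail_Kx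
    have lKy : StochAPD.HasLightTail (StochAPD.centered O.Ky ν) S.Y ν σxK :=
      StochAPD.hasLightTail_centered hO.mean_Ky hA2.tail_Ky
    have hk1 : StrictMono fun t : ℕ => 2 * t + 1 := fun a b h => by simp only; omega
    have hk0 : StrictMono fun t : ℕ => 2 * t := fun a b h => by simp only; omega
    have b1 := nG.measureReal_sum_gt_le hσxG lG hξm hξ hξi hk1 hmd1 hmem_md hvx hDX0 hvxR hN1 hM0
      hS hr
    have b2 := nKy.measureReal_sum_gt_le hσxK lKy hξm hξ hξi hk1 (a := fun t => y (t + 1)) hy1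
      hmem_y1 hvx hDX0 hvxR hN1 hM0 hS hr
    have b3 := nKx.measureReal_sum_gt_le hσy lKx hξm hξ hξi hk0
      (fun t ht htN => (had t ht htN.le).2.2.1) hmem_bar hvy hDY0 hvyR hN1 hM0 hS hr
    have b4 := nG.measureReal_sum_sq_gt_le hσxG lG hξm hξ hξi hmd1 hmem_md hN r
    have b5 := nKy.measureReal_sum_sq_gt_le hσxK lKy hξm hξ hξi (a := fun t => y (t + 1)) hy1
      hmem_y1 hN r
    have b6 := nKx.measureReal_sum_sq_gt_le hσy lKx hξm hξ hξi (k := fun t => 2 * t)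
      (fun t ht htN => (had t ht htN.le).2.2.1) hmem_bar hN r
    rw [← hsq] at b4 b5 b6
    change P.real {ω | _ < mG ω} ≤ _ at b1
    change P.real {ω | _ < mK ω} ≤ _ at b2
    change P.real {ω | _ < my ω} ≤ _ at b3
    change P.real {ω | _ < qG ω} ≤ _ at b4
    change P.real {ω | _ < qK ω} ≤ _ at b5
    change P.real {ω | _ < qy ω} ≤ _ at b6
    -- Outside the six events the terms proportional to `r` cost `1 + 4 / 9` for `x` and `2 / 3 + 2
    -- / 9` for `y`, both below the `3 / 2` in the weighted `C₁`.
    have hsub : {ω | StochAPD.C₀ S.LG ‖S.K‖ σx σy DX DY N + r * StochAPD.C₁ σx σy DX DY N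
          < S.gap (xag N ω, yag N ω)} ⊆
        (({ω | 2 / 3 * r * (σxG * DX * M) < mG ω} ∪ {ω | 2 / 3 * r * (σxK * DX * M) < mK ω}) ∪
          {ω | 2 / 3 * r * (σy * DY * M) < my ω}) ∪
        (({ω | (1 + r) * (σxG ^ 2 * sq) < qG ω} ∪ {ω | (1 + r) * (σxK ^ 2 * sq) < qK ω}) ∪
          {ω | (1 + r) * (σy ^ 2 * sq) < qy ω}) := by
      intro ω hω
      by_contra hcon
      simp only [Set.mem_union, Set.mem_ofPred_eq, not_or, not_lt] at hcon hω
      obtain ⟨⟨⟨h1, h2⟩, h3⟩, ⟨h4, h5⟩, h6⟩ := hcon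
      have h7 := mul_lt_mul_of_pos_left (hω.trans_le (hgapB ω)) hκ
      rw [mul_div_cancel₀ _ hκ.ne', mul_add, mul_left_comm, ← hLK, hC0, hC1] at h7
      have h8 : (qG ω + qK ω) / rx ≤ (1 + r) * (4 / 9 * (σx * DX * M)) := by
        calc (qG ω + qK ω) / rx ≤ ((1 + r) * (σxG ^ 2 * sq) + (1 + r) * (σxK ^ 2 * sq)) / rx := by
              gcongr
          _ = (1 + r) * ((σxG ^ 2 * sq + σxK ^ 2 * sq) / rx) := by ring
          _ ≤ _ := by gcongr
      have h9 : qy ω / (2 * ry) ≤ (1 + r) * (2 / 9 * (σy * DY * M)) := by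
        calc qy ω / (2 * ry) ≤ ((1 + r) * (σy ^ 2 * sq)) / (2 * ry) := by gcongr
          _ = (1 + r) * (σy ^ 2 * sq / (2 * ry)) := by ring
          _ ≤ _ := by gcongr
      have h10 : 2 / 3 * r * (σxG * DX * M) + 2 / 3 * r * (σxK * DX * M) ≤ r * (σx * DX * M) := by
        have h11 := StochAPD.add_le_mul_sqrt σxG σxK
        rw [← hσx] at h11
        calc _ = 2 / 3 * r * DX * M * (σxG + σxK) := by ring
          _ ≤ 2 / 3 * r * DX * M * (3 / 2 * σx) := by gcongr
          _ = _ := by ring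
      have hrX := mul_nonneg hr.le hpX
      have hrY := mul_nonneg hr.le hpY
      simp only [B] at h7
      linarith
    calc _ ≤ _ := measureReal_mono hsub
      _ ≤ ((Real.exp (-r ^ 2 / 3) + Real.exp (-r ^ 2 / 3)) + Real.exp (-r ^ 2 / 3)) +
          ((Real.exp (-r) + Real.exp (-r)) + Real.exp (-r)) := by
          refine (measureReal_union_le _ _).trans (add_le_add ?_ ?_)
          · exact (measureReal_union_le _ _).trans
              (add_le_add ((measureReal_union_le _ _).trans (add_le_add b1 b2)) b3)
          · exact (measureReal_union_le _ _).trans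
              (add_le_add ((measureReal_union_le _ _).trans (add_le_add b4 b5)) b6)
      _ = _ := by ring
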